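/- Let $M=\mathbb{Z}^n$, $N=\mathrm{Hom}(M,\mathbb{Z})$, and let $X$ be the complex toric variety (covered by the charts $U_\sigma=\mathrm{Spec}\,\mathbb{C}[\sigma^\vee\cap N]$) of a fan $\Sigma$ of strongly convex rational polyhedral cones in $M_{\mathbb{R}}=M\otimes_{\mathbb{Z}}\mathbb{R}$. Equip $X$ and $\mathbb{P}^1=\mathbb{P}^1_{\mathbb{C}}$ with their standard real structures. A *line* in $X$ is a non-constant morphism $\varphi:\mathbb{P}^1\to X$ such that the preimage of the big torus orbit is dense, the image is disjoint from all toric strata of codimension greater than $1$, $\sharp\,\varphi^{-1}(D)\le 1$ for every toric divisor $D$, and $\varphi^{-1}(D)\neq\emptyset$ for at most three toric divisors $D$. It is *real* if $\varphi$ commutes with the real structures. It is of *type* $(\mathbf u,\mathbf w)=((u_i)_{1\le i\le a},(w_i)_{1\le i\le a})$ if the toric divisors that it meets are exactly the pairwise distinct divisors $D_i$ ($1\le i\le a$) corresponding to the rays $\mathbb{R}_{\ge 0}u_i$ of $\Sigma$, with $u_i\in M$ primitive, and $w_i=\deg\varphi^*D_i$ for all $i$. Two lines $\varphi,\psi$ are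 isomorphic if $\psi=\varphi\circ g$ for some automorphism $g\in \mathrm{PGL}_2(\mathbb{C})$ of $\mathbb{P}^1$. Let $a\in\{2,3\}$, let $u_1,\dots,u_a\in M$ be pairwise distinct primitive vectors such that the $\mathbb{R}_{\ge0}u_i$ are rays of $\Sigma$, and let $w_1,\dots,w_a$ be positive integers with $\sum_{i=1}^a w_iu_i=0$. Let $\mathcal{L}^{\mathbb{R}}_{(\mathbf u,\mathbf w)}$ be the moduli space of real lines of type $(\mathbf u,\mathbf w)$, that is, the set of those isomorphism classes of lines of type $(\mathbf u,\mathbf w)$ that contain a real line. Then $\mathcal{L}^{\mathbb{R}}_{(\mathbf u,\mathbf w)}$ is nonempty, and the action of the real torus $M\otimes_{\mathbb{Z}}\mathbb{R}^\times$ on $X$ induces, by composition $t\cdot[\varphi]=[t\circ\varphi]$, a well-defined transitive action of $M\otimes_{\mathbb{Z}}\mathbb{R}^\times$ on $\mathcal{L}^{\mathbb{R}}_{(\mathbf u,\mathbf w)}$. If $a=3$ (the trivalent case), this action is simply transitive. If $a=2$ (the divalent case), then $\mathbb{Z}u_1=\mathbb{Z}u_2$ and the action factors, through the projection $M\otimes_{\mathbb{Z}}\mathbb{R}^\times\to(M/\mathbb{Z}u_1)\otimes_{\mathbb{Z}}\mathbb{R}^\times$,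 over a simply transitive action of $(M/\mathbb{Z}u_1)\otimes_{\mathbb{Z}}\mathbb{R}^\times=(M/\mathbb{Z}u_2)\otimes_{\mathbb{Z}}\mathbb{R}^\times$. -/

import Mathlib

open scoped LinearAlgebra.Projectivization TensorProduct

namespace ToricLines

/-! ## Lattices, cones and fans

`M = ℤⁿ`, `M_ℝ = ℝⁿ` and `N = Hom(M, ℤ)`. -/

/-- The lattice `M = ℤⁿ`. -/
abbrev Lat (n : ℕ) : Type := Fin n → ℤ

/-- The dual lattice `N = Hom(M, ℤ)`, the lattice of monomials. -/
abbrev DualLat (n : ℕ) : Type := Module.Dual ℤ (Lat n)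

/-- Convex cones (containing the origin) in `M_ℝ = ℝⁿ`. -/
abbrev Cone (n : ℕ) : Type := PointedCone ℝ (Fin n → ℝ)

/-- The inclusion `M → M_ℝ`. -/
def latToReal {n : ℕ} (u : Lat n) : Fin n → ℝ := fun i => (u i : ℝ)

/-- The duality pairing `N × M_ℝ → ℝ`, extending the evaluation `N × M → ℤ`. -/
def pairing {n : ℕ} (m : DualLat n) (v : Fin n → ℝ) : ℝ :=
  ∑ i, (m (Pi.single i 1) : ℝ) * v i

/-- A lattice vector is primitive if it is not a proper multiple of a lattice vector
(in particular it is nonzero). -/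
def IsPrimitive {n : ℕ} (u : Lat n) : Prop :=
  ∀ (k : ℤ) (v : Lat n), u = k • v → IsUnit k

/-- The half line `ℝ_{≥ 0} u`. -/
def ray {n : ℕ} (u : Lat n) : Cone n := PointedCone.hull ℝ {latToReal u}

/-- The dimension of a cone. -/
noncomputable def coneDim {n : ℕ} (σ : Cone n) : ℕ :=
  Module.finrank ℝ (Submodule.span ℝ (σ : Set (Fin n → ℝ)))

/-- The monoid `σ^∨ ∩ N`. -/
def dualMonoid {n : ℕ} (σ : Cone n) : AddSubmonoid (DualLat n) where
  carrier := {m | ∀ v ∈ σ, 0 ≤ pairing m v}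
  zero_mem' := fun v _ => by simp [pairing]
  add_mem' := fun {a b} ha hb v hv => by
    have h : pairing (a + b) v = pairing a v + pairing b v := by
      simp [pairing, add_mul, Finset.sum_add_distrib]
    rw [h]
    exact add_nonneg (ha v hv) (hb v hv)

/-- A rational polyhedral cone: generated by finitely many lattice vectors. -/
def IsRationalPolyhedral {n : ℕ} (σ : Cone n) : Prop :=
  ∃ s : Finset (Lat n), σ = PointedCone.hull ℝ (latToReal '' (s : Set (Lat n)))

/-- A strongly convex cone: it contains no line. -/
def IsStronglyConvex {n : ℕ} (σ : Cone n) : Prop :=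
  ∀ v ∈ σ, -v ∈ σ → v = 0

/-- `τ` is a face of the (rational polyhedral) cone `σ`: `τ = σ ∩ m^⊥` for some
`m ∈ σ^∨ ∩ N`. -/
def IsFace {n : ℕ} (τ σ : Cone n) : Prop :=
  ∃ m ∈ dualMonoid σ, ∀ v, v ∈ τ ↔ v ∈ σ ∧ pairing m v = 0

/-- A fan in `M_ℝ`. -/
structure Fan (n : ℕ) where
  cones : Set (Cone n)
  finite : cones.Finite
  nonempty : cones.Nonempty
  rational : ∀ σ ∈ cones, IsRationalPolyhedral σ
  stronglyConvex : ∀ σ ∈ cones, IsStronglyConvex σ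
  face_mem : ∀ σ ∈ cones, ∀ τ, IsFace τ σ → τ ∈ cones
  inter_face : ∀ σ ∈ cones, ∀ τ ∈ cones, IsFace (σ ⊓ τ) σ ∧ IsFace (σ ⊓ τ) τ

/-! ## The complex toric variety of a fan -/

/-- The complex points of the affine toric variety `U_σ = Spec ℂ[σ^∨ ∩ N]`, that is, the monoid
homomorphisms from `σ^∨ ∩ N` to `(ℂ, ·)`. The value at `m` is the value of the monomial `z^m`. -/
abbrev AffineChart {n : ℕ} (σ : Cone n) : Type :=
  Multiplicative (dualMonoid σ) →* ℂ

/-- The value of the monomial `z^m` at a point of `U_σ`. -/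
def monomial {n : ℕ} {σ : Cone n} (m : dualMonoid σ) (x : AffineChart σ) : ℂ :=
  x (Multiplicative.ofAdd m)

theorem dualMonoid_anti {n : ℕ} {σ τ : Cone n} (h : τ ≤ σ) : dualMonoid σ ≤ dualMonoid τ :=
  fun _ hm v hv => hm v (h hv)

/-- The map `U_τ → U_σ` for `τ ⊆ σ`, restricting monomials from `τ^∨ ∩ N` to `σ^∨ ∩ N`. -/
def chartMap {n : ℕ} {σ τ : Cone n} (h : τ ≤ σ) (z : AffineChart τ) : AffineChart σ :=
  z.comp (AddMonoidHom.toMultiplicative (AddSubmonoid.inclusion (dualMonoid_anti h)))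

theorem monomial_chartMap {n : ℕ} {σ τ : Cone n} (h : τ ≤ σ) (z : AffineChart τ)
    (m : dualMonoid σ) :
    monomial m (chartMap h z) = monomial ⟨m.1, dualMonoid_anti h m.2⟩ z := rfl

theorem monomial_add {n : ℕ} {σ : Cone n} (m m' : dualMonoid σ) (x : AffineChart σ) :
    monomial (m + m') x = monomial m x * monomial m' x :=
  map_mul x (Multiplicative.ofAdd m) (Multiplicative.ofAdd m')

theorem monomial_zero {n : ℕ} {σ : Cone n} (x : AffineChart σ) :
    monomial (0 : dualMonoid σ) x = 1 := map_one x

theorem monomial_nsmul {n : ℕ} {σ : Cone n} (k : ℕ) (m : dualMonoid σ) (x : AffineChart σ) :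
    monomial (k • m) x = monomial m x ^ k := by
  induction k with
  | zero => simp [monomial_zero]
  | succ k ih => rw [succ_nsmul, monomial_add, ih, pow_succ]

theorem chart_ext {n : ℕ} {σ : Cone n} {x y : AffineChart σ}
    (h : ∀ m, monomial m x = monomial m y) : x = y :=
  MonoidHom.ext fun m => h (Multiplicative.toAdd m)

theorem pairing_add {n : ℕ} (a b : DualLat n) (v : Fin n → ℝ) :
    pairing (a + b) v = pairing a v + pairing b v := by
  simp [pairing, add_mul, Finset.sum_add_distrib]

theorem pairing_nsmul {n : ℕ} (k : ℕ) (a : DualLat n) (v : Fin n → ℝ) :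
    pairing (k • a) v = k * pairing a v := by
  simp [pairing, Finset.mul_sum, mul_assoc]

theorem pairing_neg {n : ℕ} (a : DualLat n) (v : Fin n → ℝ) :
    pairing (-a) v = - pairing a v := by
  simp [pairing]

theorem pairing_latToReal {n : ℕ} (a : DualLat n) (u : Lat n) :
    pairing a (latToReal u) = (a u : ℝ) := by
  have h : a u = ∑ i, a (Pi.single i 1) * u i := by
    conv_lhs => rw [← Finset.univ_sum_single u, map_sum]
    refine Finset.sum_congr rfl fun i _ => ?_
    have : (Pi.single i (u i) : Lat n) = u i • Pi.single i 1 := by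
      rw [← Pi.single_smul]; simp
    rw [this, map_smul, smul_eq_mul, mul_comm]
  simp [pairing, latToReal, h]

theorem mem_dualMonoid_hull {n : ℕ} (s : Finset (Lat n)) (m : DualLat n) :
    m ∈ dualMonoid (PointedCone.hull ℝ (latToReal '' (s : Set (Lat n)))) ↔ ∀ u ∈ s, 0 ≤ m u := by
  constructor
  · intro h u hu
    have := h (latToReal u) (Submodule.subset_span ⟨u, hu, rfl⟩)
    rw [pairing_latToReal] at this
    exact_mod_cast this
  · intro h v hv
    induction hv using Submodule.span_induction with
    | mem x hx =>
      obtain ⟨u, hu, rfl⟩ := hx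
      rw [pairing_latToReal]
      exact_mod_cast h u hu
    | zero => simp [pairing]
    | add x y _ _ hx hy =>
      have : pairing m (x + y) = pairing m x + pairing m y := by
        simp [pairing, mul_add, Finset.sum_add_distrib]
      rw [this]; exact add_nonneg hx hy
    | smul a x _ hx =>
      have : pairing m (a • x) = (a : ℝ) * pairing m x := by
        simp only [pairing, Finset.mul_sum]
        refine Finset.sum_congr rfl fun i _ => ?_
        rw [show (a • x) i = (a : ℝ) * x i from rfl]; ring
      rw [this]; exact mul_nonneg a.2 hx

/-- If `τ = σ ∩ m^⊥`, every element of `τ^∨ ∩ N` is moved into `σ^∨ ∩ N` by a multiple of `m`. -/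
theorem exists_add_nsmul_mem {n : ℕ} {σ τ : Cone n} (hσ : IsRationalPolyhedral σ)
    {m : DualLat n} (hm : m ∈ dualMonoid σ) (hτ : ∀ v, v ∈ τ ↔ v ∈ σ ∧ pairing m v = 0)
    {l : DualLat n} (hl : l ∈ dualMonoid τ) : ∃ k : ℕ, l + k • m ∈ dualMonoid σ := by
  obtain ⟨s, rfl⟩ := hσ
  refine ⟨∑ u ∈ s, (l u).natAbs, ?_⟩
  rw [mem_dualMonoid_hull] at hm ⊢
  intro u hu
  simp only [LinearMap.add_apply, LinearMap.smul_apply, nsmul_eq_mul]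
  rcases (hm u hu).eq_or_lt with h0 | h1
  · have hu' : latToReal u ∈ τ := by
      rw [hτ]
      refine ⟨Submodule.subset_span ⟨u, hu, rfl⟩, ?_⟩
      rw [pairing_latToReal, ← h0]; simp
    have := hl _ hu'
    rw [pairing_latToReal] at this
    rw [← h0]; simpa using (by exact_mod_cast this : 0 ≤ l u)
  · have h2 : (l u).natAbs ≤ ∑ u ∈ s, (l u).natAbs :=
      Finset.single_le_sum (f := fun u => (l u).natAbs) (fun _ _ => Nat.zero_le _) hu
    have h3 : -((l u).natAbs : ℤ) ≤ l u := by omega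
    have h4 : ((l u).natAbs : ℤ) ≤ ((∑ u ∈ s, (l u).natAbs : ℕ) : ℤ) := by exact_mod_cast h2
    nlinarith [mul_le_mul h4 (by omega : (1 : ℤ) ≤ m u) (by norm_num) (by positivity)]

theorem neg_mem_dualMonoid {n : ℕ} {σ τ : Cone n} {m : DualLat n}
    (hτ : ∀ v, v ∈ τ ↔ v ∈ σ ∧ pairing m v = 0) : -m ∈ dualMonoid τ := fun v hv => by
  rw [pairing_neg, ((hτ v).1 hv).2, neg_zero]

theorem face_le {n : ℕ} {σ τ : Cone n} {m : DualLat n}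
    (hτ : ∀ v, v ∈ τ ↔ v ∈ σ ∧ pairing m v = 0) : τ ≤ σ := fun v hv => ((hτ v).1 hv).1

theorem monomial_ne_zero {n : ℕ} {σ τ : Cone n} {m : DualLat n} (hm : m ∈ dualMonoid σ)
    (hτ : ∀ v, v ∈ τ ↔ v ∈ σ ∧ pairing m v = 0) (z : AffineChart τ) :
    monomial ⟨m, hm⟩ (chartMap (face_le hτ) z) ≠ 0 := by
  rw [monomial_chartMap]
  intro h
  have h1 := monomial_add ⟨m, dualMonoid_anti (face_le hτ) hm⟩ ⟨-m, neg_mem_dualMonoid hτ⟩ z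
  have h2 : (⟨m, dualMonoid_anti (face_le hτ) hm⟩ + ⟨-m, neg_mem_dualMonoid hτ⟩ : dualMonoid τ) = 0 :=
    Subtype.ext (add_neg_cancel m)
  rw [h2, monomial_zero] at h1
  rw [h, zero_mul] at h1
  exact one_ne_zero h1

/-- `U_τ → U_σ` is injective for a face `τ` of `σ`. -/
theorem chartMap_injective {n : ℕ} {σ τ : Cone n} (hσ : IsRationalPolyhedral σ)
    (h : IsFace τ σ) (hle : τ ≤ σ) {z z' : AffineChart τ}
    (hz : chartMap hle z = chartMap hle z') : z = z' := by
  obtain ⟨m, hm, hτ⟩ := h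
  refine chart_ext fun l => ?_
  obtain ⟨k, hk⟩ := exists_add_nsmul_mem hσ hm hτ l.2
  have key : ∀ w : AffineChart τ, monomial ⟨l.1 + k • m, hk⟩ (chartMap hle w)
      = monomial l w * monomial ⟨m, hm⟩ (chartMap hle w) ^ k := by
    intro w
    rw [monomial_chartMap, monomial_chartMap, ← monomial_nsmul, ← monomial_add]
    rfl
  have h1 := key z
  rw [hz, key z'] at h1
  exact (mul_right_cancel₀ (pow_ne_zero k (monomial_ne_zero hm hτ z')) h1).symm

/-- `U_τ` is the locus `z^m ≠ 0` in `U_σ` for the face `τ = σ ∩ m^⊥`. -/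
theorem exists_chart_lift {n : ℕ} {σ τ : Cone n} (hσ : IsRationalPolyhedral σ)
    {m : DualLat n} (hm : m ∈ dualMonoid σ) (hτ : ∀ v, v ∈ τ ↔ v ∈ σ ∧ pairing m v = 0)
    (y : AffineChart σ) (hy : monomial ⟨m, hm⟩ y ≠ 0) :
    ∃ z : AffineChart τ, chartMap (face_le hτ) z = y := by
  choose k hk using fun l : dualMonoid τ => exists_add_nsmul_mem hσ hm hτ l.2
  set c := monomial ⟨m, hm⟩ y with hc
  have key : ∀ (l : DualLat n) (a b : ℕ) (ha : l + a • m ∈ dualMonoid σ)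
      (hb : l + b • m ∈ dualMonoid σ),
      monomial ⟨_, ha⟩ y * c ^ b = monomial ⟨_, hb⟩ y * c ^ a := by
    intro l a b ha hb
    rw [hc, ← monomial_nsmul, ← monomial_nsmul, ← monomial_add, ← monomial_add]
    congr 1
    apply Subtype.ext
    change l + a • m + b • m = l + b • m + a • m
    abel
  let f : dualMonoid τ → ℂ := fun l => monomial ⟨_, hk l⟩ y / c ^ k l
  have hf : ∀ (l : dualMonoid τ) (a : ℕ) (ha : l.1 + a • m ∈ dualMonoid σ),
      f l = monomial ⟨_, ha⟩ y / c ^ a := by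
    intro l a ha
    simp only [f]
    rw [div_eq_div_iff (pow_ne_zero _ hy) (pow_ne_zero _ hy)]
    exact key _ _ _ _ _
  have hf0 : ∀ (l : dualMonoid τ) (hl : l.1 ∈ dualMonoid σ), f l = monomial ⟨_, hl⟩ y := by
    intro l hl
    rw [hf l 0 (by simpa using hl), pow_zero, div_one]
    congr 1
    apply Subtype.ext
    simp
  refine ⟨{ toFun := fun l => f l.toAdd, map_one' := ?_, map_mul' := ?_ }, ?_⟩
  · have := hf0 0 (dualMonoid σ).zero_mem
    exact this.trans (monomial_zero y)
  · intro l l'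
    have h1 : (l.toAdd + l'.toAdd).1 + (k l.toAdd + k l'.toAdd) • m ∈ dualMonoid σ := by
      have := (dualMonoid σ).add_mem (hk l.toAdd) (hk l'.toAdd)
      have e : (l.toAdd + l'.toAdd).1 + (k l.toAdd + k l'.toAdd) • m
          = (l.toAdd.1 + k l.toAdd • m) + (l'.toAdd.1 + k l'.toAdd • m) := by
        simp only [AddSubmonoid.coe_add, add_smul]; abel
      rw [e]; exact this
    change f (l.toAdd + l'.toAdd) = f l.toAdd * f l'.toAdd
    rw [hf _ _ h1]
    simp only [f]
    rw [div_mul_div_comm, ← pow_add, ← monomial_add]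
    congr 2
    apply Subtype.ext
    simp only [AddSubmonoid.coe_add, add_smul]; abel
  · refine chart_ext fun l => ?_
    exact hf0 ⟨l.1, dualMonoid_anti (face_le hτ) l.2⟩ l.2

/-- Two points of affine charts are identified if they come from a point of
`U_{σ ∩ τ} = U_σ ∩ U_τ`. -/
def Glued {n : ℕ} (F : Fan n) (a b : Σ σ : F.cones, AffineChart σ.1) : Prop :=
  ∃ z : AffineChart (a.1.1 ⊓ b.1.1),
    chartMap inf_le_left z = a.2 ∧ chartMap inf_le_right z = b.2

theorem glued_equivalence {n : ℕ} (F : Fan n) : Equivalence (Glued F) where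
  refl := by
    rintro ⟨σ, x⟩
    exact ⟨chartMap (le_inf le_rfl le_rfl) x, rfl, rfl⟩
  symm := by
    rintro ⟨σ, x⟩ ⟨τ, y⟩ ⟨z, h1, h2⟩
    exact ⟨chartMap (le_inf inf_le_right inf_le_left) z, h2, h1⟩
  trans := by
    rintro ⟨⟨σ, hσ⟩, x⟩ ⟨⟨τ, hτ⟩, y⟩ ⟨⟨ρ, hρ⟩, w⟩ ⟨z, hz1, hz2⟩ ⟨z', hz1', hz2'⟩
    dsimp only at z z' hz1 hz2 hz1' hz2'
    have rat := F.rational τ hτ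
    have face1 := (F.inter_face σ hσ τ hτ).2
    have face2 := (F.inter_face τ hτ ρ hρ).1
    obtain ⟨m, hm, hmτ⟩ := id face1
    obtain ⟨m', hm', hmτ'⟩ := id face2
    have ym : monomial ⟨m, hm⟩ y ≠ 0 := by
      rw [← hz2]; exact monomial_ne_zero hm hmτ z
    have ym' : monomial ⟨m', hm'⟩ y ≠ 0 := by
      rw [← hz1']; exact monomial_ne_zero hm' hmτ' z'
    have hη : ∀ v, v ∈ (σ ⊓ τ) ⊓ (τ ⊓ ρ) ↔ v ∈ τ ∧ pairing (m + m') v = 0 := by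
      intro v
      rw [Submodule.mem_inf, hmτ, hmτ', pairing_add]
      constructor
      · rintro ⟨⟨h1, h2⟩, -, h3⟩
        exact ⟨h1, by rw [h2, h3, add_zero]⟩
      · rintro ⟨h1, h2⟩
        have := hm v h1
        have := hm' v h1
        exact ⟨⟨h1, by linarith⟩, h1, by linarith⟩
    obtain ⟨t, ht⟩ := exists_chart_lift rat ((dualMonoid τ).add_mem hm hm') hη y (by
      have := monomial_add ⟨m, hm⟩ ⟨m', hm'⟩ y
      exact fun h => mul_ne_zero ym ym' (this.symm.trans h))
    have e1 : chartMap inf_le_left t = z :=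
      chartMap_injective rat face1 inf_le_right (ht.trans hz2.symm)
    have e2 : chartMap inf_le_right t = z' :=
      chartMap_injective rat face2 inf_le_left (ht.trans hz1'.symm)
    refine ⟨chartMap (le_inf (inf_le_left.trans inf_le_left) (inf_le_right.trans inf_le_right)) t,
      ?_, ?_⟩
    · dsimp only
      rw [← hz1, ← e1]; rfl
    · dsimp only
      rw [← hz2', ← e2]; rfl

/-- The gluing of the affine charts. -/
instance gluing {n : ℕ} (F : Fan n) : Setoid (Σ σ : F.cones, AffineChart σ.1) :=
  ⟨Glued F, glued_equivalence F⟩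

/-- The (complex points of the) toric variety `X` of a fan in `M_ℝ`, obtained by gluing
the affine toric varieties `U_σ` and `U_τ` along `U_{σ ∩ τ}`. -/
abbrev ToricVariety {n : ℕ} (F : Fan n) : Type := Quotient (gluing F)

/-- The inclusion of the chart `U_σ` in `X`. -/
def ofChart {n : ℕ} (F : Fan n) (σ : F.cones) (x : AffineChart σ.1) : ToricVariety F :=
  Quotient.mk (gluing F) ⟨σ, x⟩

/-- A map of charts which is compatible with the restriction maps induces a map on `X`. -/
def mapCharts {n : ℕ} (F : Fan n) (f : ∀ σ : Cone n, AffineChart σ → AffineChart σ)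
    (hf : ∀ (σ τ : Cone n) (h : τ ≤ σ) (z : AffineChart τ),
      f σ (chartMap h z) = chartMap h (f τ z)) :
    ToricVariety F → ToricVariety F :=
  Quotient.map (fun a => ⟨a.1, f a.1.1 a.2⟩) (by
    rintro ⟨σ, x⟩ ⟨τ, y⟩ ⟨z, h1, h2⟩
    refine ⟨f _ z, ?_, ?_⟩
    · exact (hf _ _ _ _).symm.trans (congrArg _ h1)
    · exact (hf _ _ _ _).symm.trans (congrArg _ h2))

/-- The standard real structure on `X`: complex conjugation of the values of all monomials. -/
noncomputable def toricConj {n : ℕ} (F : Fan n) : ToricVariety F → ToricVariety F :=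
  mapCharts F (fun _ x => (starRingEnd ℂ : ℂ →* ℂ).comp x) (fun _ _ _ _ => rfl)

/-- The real torus `M ⊗ ℝ^×` (written additively). -/
abbrev RealTorus (n : ℕ) : Type := Lat n ⊗[ℤ] Additive ℝˣ

/-- The character `z^m` of the torus: `z^m (u ⊗ r) = r ^ ⟨m, u⟩`. -/
noncomputable def torusChar {n : ℕ} (m : DualLat n) (t : RealTorus n) : ℝˣ :=
  Additive.toMul (TensorProduct.lid ℤ (Additive ℝˣ) (LinearMap.rTensor (Additive ℝˣ) m t))

theorem torusChar_zero {n : ℕ} (t : RealTorus n) : torusChar 0 t = 1 := by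
  simp [torusChar]

theorem torusChar_add {n : ℕ} (m m' : DualLat n) (t : RealTorus n) :
    torusChar (m + m') t = torusChar m t * torusChar m' t := by
  simp [torusChar, LinearMap.rTensor_add]

/-- The action of `M ⊗ ℝ^× ⊆ M ⊗ ℂ^×` on `U_σ`: the coordinate `z^m` is multiplied by `z^m(t)`. -/
noncomputable def chartTranslate {n : ℕ} (t : RealTorus n) (σ : Cone n) (x : AffineChart σ) :
    AffineChart σ where
  toFun m := (((torusChar (Multiplicative.toAdd m).1 t : ℝˣ) : ℝ) : ℂ) * x m
  map_one' := by simp [torusChar_zero]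
  map_mul' m m' := by
    simp only [toAdd_mul, AddSubmonoid.coe_add, torusChar_add, map_mul, Units.val_mul,
      Complex.ofReal_mul]
    ring

/-- The action of `M ⊗ ℝ^×` on the toric variety `X`. -/
noncomputable def torusTranslate {n : ℕ} (F : Fan n) (t : RealTorus n) :
    ToricVariety F → ToricVariety F :=
  mapCharts F (chartTranslate t) (fun _ _ _ _ => rfl)

/-- The torus orbit `O_σ` of a cone of the fan: the points of `U_σ` at which exactly the monomials
in `σ^⊥ ∩ N` do not vanish. -/
def torusOrbit {n : ℕ} (F : Fan n) (σ : F.cones) : Set (ToricVariety F) :=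
  {p | ∃ x : AffineChart σ.1, p = ofChart F σ x ∧
    ∀ m : dualMonoid σ.1, monomial m x ≠ 0 ↔ ∀ v ∈ σ.1, pairing m.1 v = 0}

/-- The closed toric stratum of `σ`, of codimension `dim σ`: the closure of `O_σ`, which is the union
of the orbits `O_τ` over the cones `τ ⊇ σ` of the fan. For a ray this is a toric divisor. -/
def toricStratum {n : ℕ} (F : Fan n) (σ : F.cones) : Set (ToricVariety F) :=
  {p | ∃ τ : F.cones, σ.1 ≤ τ.1 ∧ p ∈ torusOrbit F τ}

/-- The big torus orbit: the orbit of the zero cone. -/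
def bigTorus {n : ℕ} (F : Fan n) : Set (ToricVariety F) :=
  {p | ∃ σ : F.cones, coneDim σ.1 = 0 ∧ p ∈ torusOrbit F σ}

/-! ## The projective line and its maps to a toric variety -/

/-- The complex projective line. -/
abbrev P1 : Type := ℙ ℂ (Fin 2 → ℂ)

/-- Homogeneous coordinates of points are only used in expressions that do not depend on
their choice. -/
noncomputable def evalAt (P : MvPolynomial (Fin 2) ℂ) (p : P1) : ℂ := MvPolynomial.eval p.rep P

/-- The property `T` holds on a Zariski neighbourhood of `p`, of the form `{R ≠ 0}`
for a homogeneous polynomial `R`. -/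
def NearPoint (p : P1) (T : P1 → Prop) : Prop :=
  ∃ (d : ℕ) (R : MvPolynomial (Fin 2) ℂ), R.IsHomogeneous d ∧ evalAt R p ≠ 0 ∧
    ∀ q, evalAt R q ≠ 0 → T q

/-- `g` is a regular function near `p`: a quotient `P / Q` of homogeneous polynomials of the same
degree with `Q(p) ≠ 0`. -/
def IsRegularAt (g : P1 → ℂ) (p : P1) : Prop :=
  ∃ (d : ℕ) (P Q : MvPolynomial (Fin 2) ℂ), P.IsHomogeneous d ∧ Q.IsHomogeneous d ∧
    evalAt Q p ≠ 0 ∧ NearPoint p (fun q => g q = evalAt P q / evalAt Q q)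

/-- `g` is regular near `p` and vanishes at `p` to order exactly `k`: near `p` it is of the form
`ℓ ^ k R / Q` where `ℓ` is the linear form vanishing at `p` and `R(p) ≠ 0`, `Q(p) ≠ 0`. -/
def HasVanishingOrder (g : P1 → ℂ) (p : P1) (k : ℕ) : Prop :=
  ∃ (d : ℕ) (R Q : MvPolynomial (Fin 2) ℂ), R.IsHomogeneous d ∧ Q.IsHomogeneous (k + d) ∧
    evalAt R p ≠ 0 ∧ evalAt Q p ≠ 0 ∧
    NearPoint p (fun q => g q =
      evalAt (MvPolynomial.C (p.rep 1) * MvPolynomial.X 0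
        - MvPolynomial.C (p.rep 0) * MvPolynomial.X 1) q ^ k * evalAt R q / evalAt Q q)

/-- A morphism of algebraic varieties `ℙ¹ → X`: every point has a neighbourhood which is mapped to
an affine chart `U_σ` in such a way that all coordinates `z^m` are regular. -/
def IsMorphism {n : ℕ} (F : Fan n) (φ : P1 → ToricVariety F) : Prop :=
  ∀ p, ∃ (σ : F.cones) (x : P1 → AffineChart σ.1),
    NearPoint p (fun q => φ q = ofChart F σ (x q)) ∧
    ∀ m : dualMonoid σ.1, IsRegularAt (fun q => monomial m (x q)) p

/-- A torically transverse map: the preimage of the big torus orbit is (Zariski) dense, and the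
image is disjoint from all toric strata of codimension greater than one. -/
def IsToricallyTransverse {n : ℕ} (F : Fan n) (φ : P1 → ToricVariety F) : Prop :=
  (∀ (d : ℕ) (R : MvPolynomial (Fin 2) ℂ), R.IsHomogeneous d → R ≠ 0 →
    ∃ q, evalAt R q ≠ 0 ∧ φ q ∈ bigTorus F) ∧
  ∀ σ : F.cones, 1 < coneDim σ.1 → ∀ p, φ p ∉ toricStratum F σ

/-- A line: a non-constant torically transverse morphism `ℙ¹ → X` which meets each toric divisor in
at most one point of `ℙ¹`, and meets at most three toric divisors. -/
structure IsLine {n : ℕ} (F : Fan n) (φ : P1 → ToricVariety F) : Prop where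
  isMorphism : IsMorphism F φ
  nonconstant : ∃ p q, φ p ≠ φ q
  transverse : IsToricallyTransverse F φ
  subsingleton : ∀ ρ : F.cones, coneDim ρ.1 = 1 → (φ ⁻¹' toricStratum F ρ).Subsingleton
  card_le : {ρ : F.cones | coneDim ρ.1 = 1 ∧ (φ ⁻¹' toricStratum F ρ).Nonempty}.encard ≤ 3

/-- The standard real structure on `ℙ¹`: complex conjugation of the homogeneous coordinates. -/
noncomputable def conjP1 : P1 → P1 :=
  Projectivization.map (starLinearEquiv ℂ (A := Fin 2 → ℂ)).toLinearMap
    (starLinearEquiv ℂ (A := Fin 2 → ℂ)).injective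

/-- A real map: it commutes with the standard real structures. -/
def IsRealMap {n : ℕ} (F : Fan n) (φ : P1 → ToricVariety F) : Prop :=
  ∀ p, φ (conjP1 p) = toricConj F (φ p)

/-- `φ` meets the divisor `D` of the ray `ρ`, with primitive generator `u`, at `p` with
multiplicity `k`: near `p`, the map `φ` takes values in `U_ρ`, and the pull-back of the local
equation `z^m` of `D` in `U_ρ`, where `⟨m, u⟩ = 1`, vanishes at `p` to order `k`. -/
def HasContactOrder {n : ℕ} (F : Fan n) (φ : P1 → ToricVariety F) (ρ : F.cones) (u : Lat n)
    (p : P1) (k : ℕ) : Prop :=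
  ∃ x : P1 → AffineChart ρ.1, NearPoint p (fun q => φ q = ofChart F ρ (x q)) ∧
    ∃ m : dualMonoid ρ.1, m.1 u = 1 ∧ HasVanishingOrder (fun q => monomial m (x q)) p k

/-- The intersection number `deg φ^* D` of `φ` with the divisor `D` of the ray `ρ`, with primitive
generator `u`, equals `w`: the multiplicities at the points of `φ⁻¹(D)` add up to `w`. -/
def HasIntersectionNumber {n : ℕ} (F : Fan n) (φ : P1 → ToricVariety F) (ρ : F.cones) (u : Lat n)
    (w : ℕ) : Prop :=
  ∃ (s : Finset P1) (k : P1 → ℕ), (s : Set P1) = φ ⁻¹' toricStratum F ρ ∧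
    (∀ p ∈ s, HasContactOrder F φ ρ u p (k p)) ∧ ∑ p ∈ s, k p = w

/-- `φ` is of type `(u, w)`: the toric divisors that `φ` meets are exactly those of the rays
`ℝ_{≥ 0} u_i`, and the intersection number with the divisor of `ℝ_{≥ 0} u_i` is `w_i`. -/
def HasType {n a : ℕ} (F : Fan n) (φ : P1 → ToricVariety F) (u : Fin a → Lat n) (w : Fin a → ℕ) :
    Prop :=
  (∀ ρ : F.cones, coneDim ρ.1 = 1 →
    ((φ ⁻¹' toricStratum F ρ).Nonempty ↔ ∃ i, ρ.1 = ray (u i))) ∧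
  ∀ i, ∃ ρ : F.cones, ρ.1 = ray (u i) ∧ HasIntersectionNumber F φ ρ (u i) (w i)

/-! ## The moduli space of real lines -/

/-- Real lines of type `(u, w)`, as parametrized maps. -/
def RealLine {n a : ℕ} (F : Fan n) (u : Fin a → Lat n) (w : Fin a → ℕ) : Type :=
  {φ : P1 → ToricVariety F // IsLine F φ ∧ IsRealMap F φ ∧ HasType F φ u w}

/-- Two lines are isomorphic (as stable maps) if they differ by an automorphism of the complex
projective line, that is, by an element of `PGL₂(ℂ)`. -/
instance realLineSetoid {n a : ℕ} (F : Fan n) (u : Fin a → Lat n) (w : Fin a → ℕ) :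
    Setoid (RealLine F u w) where
  r φ ψ := ∃ g : LinearMap.GeneralLinearGroup ℂ (Fin 2 → ℂ), ∀ p : P1, φ.1 (g • p) = ψ.1 p
  iseqv :=
    { refl := fun φ => ⟨1, fun p => by rw [one_smul]⟩
      symm := by
        rintro φ ψ ⟨g, hg⟩
        exact ⟨g⁻¹, fun p => by rw [← hg, smul_inv_smul]⟩
      trans := by
        rintro φ ψ χ ⟨g, hg⟩ ⟨h, hh⟩
        exact ⟨g * h, fun p => by rw [mul_smul, hg, hh]⟩ }

/-- The moduli space of real lines of type `(u, w)`: the isomorphism classes, in the moduli space of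
lines of type `(u, w)`, of real lines. -/
abbrev RealLineModuli {n a : ℕ} (F : Fan n) (u : Fin a → Lat n) (w : Fin a → ℕ) : Type :=
  Quotient (realLineSetoid F u w)

/-- The projection `M ⊗ ℝ^× → (M / ℤ u) ⊗ ℝ^×`. -/
noncomputable def torusProj {n : ℕ} (u : Lat n) :
    RealTorus n →ₗ[ℤ] (Lat n ⧸ Submodule.span ℤ {u}) ⊗[ℤ] Additive ℝˣ :=
  LinearMap.rTensor (Additive ℝˣ) (Submodule.span ℤ {u}).mkQ

end ToricLines

/-!
A line of type `(u, w)` is determined by its points of contact with the divisors and by an element of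
the torus. For a line `φ` let `v_i ∈ ℂ²` represent the unique point of `φ⁻¹(D_i)` and let `ℓ_i` be the
linear form vanishing at `v_i`. The monomial `z^m` pulls back to a rational function on the projective
line which has neither zeros nor poles outside the points `v_i`, because `φ` is torically transverse,
and which has order `w_i ⟨m, u_i⟩` at `v_i`, because the intersection numbers are prescribed. Hence
`z^m ∘ φ = c_m ∏ ℓ_i ^ (w_i ⟨m, u_i⟩)` with a constant `c_m` (`IsLine.exists_hasMonomialForm`); the
product has degree zero by the balancing condition. Such maps are called maps in monomial form.
Conversely, a map in monomial form with nonzero coefficients and pairwise distinct `v_i` is a line of type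
`(u, w)` (`HasMonomialForm.isLine`, `HasMonomialForm.hasType`), and every multiplicative family `c` occurs
(`exists_hasMonomialForm`). The key input on the toric side is that `X` is the disjoint union of its
torus orbits (`exists_mem_torusOrbit`, `torusOrbit_disjoint`), and that the coordinates of a morphism are
regular in the smallest chart containing a given point (`IsMorphism.regular_minimal_chart`).

If `φ` is real then the points and the coefficients are real, so that `c` is a point of
`Hom(N, ℝ^×) = M ⊗ ℝ^×` (`RealLine.exists_form`). A real projective transformation moves the at most three
points to `[1 : 0]`, `[0 : 1]`, `[1 : 1]`, and this puts each isomorphism class into a normal form indexed by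
`t ∈ M ⊗ ℝ^×` (`LineData.exists_equiv_isStd`). The torus acts on normal forms by translation of `t`, so
the action on the moduli space is transitive, and it remains to see which normal forms are isomorphic.
An isomorphism fixes the standard points. Three fixed points leave only the identity, so for `a = 3` the
stabilizers are trivial. For `a = 2` one has `u_1 = - u_0` and `w_1 = w_0`, and the diagonal automorphism
with entries `b_0, b_1` multiplies `c_m` by `μ ^ ⟨m, u_0⟩` with `μ = (b_1 / b_0) ^ w_0`. Since the automorphism
is allowed to be complex, every real `μ ≠ 0` occurs, and the stabilizer is `ℤ u_0 ⊗ ℝ^×`, the kernel of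
`M ⊗ ℝ^× → (M / ℤ u_0) ⊗ ℝ^×` (`LineData.equiv_iff_of_card_two`, `torusProj_eq_zero_iff`).
-/

namespace ToricLines

open Filter

/-! ### Primitive vectors, rays and faces -/

theorem IsPrimitive.ne_zero {n : ℕ} {u : Lat n} (hu : IsPrimitive u) : u ≠ 0 := by
  rintro rfl
  have h := hu 0 0 (by simp)
  simp at h

/-- The values at `u` of the linear forms are an ideal of `ℤ`, whose generator divides `u`. -/
theorem IsPrimitive.exists_dual_eq_one {n : ℕ} {u : Lat n} (hu : IsPrimitive u) :
    ∃ m : DualLat n, m u = 1 := by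
  have hmem : ∀ i, u i ∈ LinearMap.range (LinearMap.applyₗ (R := ℤ) (M₂ := ℤ) u) := fun i =>
    ⟨LinearMap.proj i, rfl⟩
  obtain ⟨g, hg⟩ := (IsPrincipalIdealRing.principal
    (LinearMap.range (LinearMap.applyₗ (R := ℤ) (M₂ := ℤ) u))).principal
  rw [hg] at hmem
  simp only [Submodule.mem_span_singleton] at hmem
  choose v hv using hmem
  have hunit := hu g v (by ext i; simp [← hv i, mul_comm])
  have h1 : (1 : ℤ) ∈ LinearMap.range (LinearMap.applyₗ (R := ℤ) (M₂ := ℤ) u) := by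
    rw [hg, Submodule.mem_span_singleton]
    obtain ⟨c, hc⟩ := hunit.exists_left_inv
    exact ⟨c, hc⟩
  obtain ⟨m, hm⟩ := h1
  exact ⟨m, hm⟩

theorem latToReal_ne_zero {n : ℕ} {u : Lat n} (hu : u ≠ 0) : latToReal u ≠ 0 := by
  intro h
  apply hu
  ext i
  have := congrFun h i
  simpa [latToReal] using this

theorem latToReal_injective {n : ℕ} : Function.Injective (latToReal (n := n)) := by
  intro u v h
  ext i
  have := congrFun h i
  simpa [latToReal] using this

theorem mem_ray {n : ℕ} {u : Lat n} {v : Fin n → ℝ} :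
    v ∈ ray u ↔ ∃ r : ℝ, 0 ≤ r ∧ v = r • latToReal u := by
  rw [ray, PointedCone.hull, Submodule.mem_span_singleton]
  constructor
  · rintro ⟨⟨r, hr⟩, h⟩
    exact ⟨r, hr, h.symm⟩
  · rintro ⟨r, hr, h⟩
    exact ⟨⟨r, hr⟩, h.symm⟩

theorem latToReal_mem_ray {n : ℕ} (u : Lat n) : latToReal u ∈ ray u :=
  mem_ray.2 ⟨1, zero_le_one, (one_smul _ _).symm⟩

theorem pairing_zero {n : ℕ} (m : DualLat n) : pairing m (0 : Fin n → ℝ) = 0 := by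
  simp [pairing]

theorem pairing_smul_right {n : ℕ} (m : DualLat n) (r : ℝ) (v : Fin n → ℝ) :
    pairing m (r • v) = r * pairing m v := by
  simp only [pairing, Finset.mul_sum, Pi.smul_apply, smul_eq_mul]
  exact Finset.sum_congr rfl fun i _ => by ring

theorem mem_dualMonoid_ray {n : ℕ} {u : Lat n} {m : DualLat n} :
    m ∈ dualMonoid (ray u) ↔ 0 ≤ m u := by
  have := mem_dualMonoid_hull {u} m
  simpa [ray] using this

theorem mem_dualMonoid_bot {n : ℕ} (m : DualLat n) : m ∈ dualMonoid (⊥ : Cone n) := by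
  intro v hv
  rw [Submodule.mem_bot] at hv
  rw [hv, pairing_zero]

/-- A lattice point of a cone takes non-negative values on the dual monoid. -/
theorem dual_nonneg {n : ℕ} {σ : Cone n} {m : DualLat n} (hm : m ∈ dualMonoid σ) {u : Lat n}
    (hu : latToReal u ∈ σ) : 0 ≤ m u := by
  have := hm _ hu
  rw [pairing_latToReal] at this
  exact_mod_cast this

theorem ray_perp {n : ℕ} {u : Lat n} {m : DualLat n} :
    (∀ v ∈ ray u, pairing m v = 0) ↔ m u = 0 := by
  constructor
  · intro h
    have := h _ (latToReal_mem_ray u)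
    rw [pairing_latToReal] at this
    exact_mod_cast this
  · intro h v hv
    obtain ⟨r, -, rfl⟩ := mem_ray.1 hv
    rw [pairing_smul_right, pairing_latToReal, h]
    simp

theorem coneDim_ray {n : ℕ} {u : Lat n} (hu : u ≠ 0) : coneDim (ray u) = 1 := by
  have : Submodule.span ℝ (ray u : Set (Fin n → ℝ)) = Submodule.span ℝ {latToReal u} := by
    apply le_antisymm
    · rw [Submodule.span_le]
      intro v hv
      obtain ⟨r, -, rfl⟩ := mem_ray.1 hv
      exact Submodule.smul_mem _ _ (Submodule.mem_span_singleton_self _)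
    · exact Submodule.span_mono (Set.singleton_subset_iff.2 (latToReal_mem_ray u))
  rw [coneDim, this, finrank_span_singleton (latToReal_ne_zero hu)]

theorem coneDim_bot {n : ℕ} : coneDim (⊥ : Cone n) = 0 := by
  rw [coneDim, Submodule.bot_coe, Submodule.span_zero_singleton, finrank_bot]

theorem eq_bot_of_coneDim_eq_zero {n : ℕ} {σ : Cone n} (h : coneDim σ = 0) : σ = ⊥ := by
  rw [coneDim, Submodule.finrank_eq_zero] at h
  rw [eq_bot_iff]
  intro v hv
  have : v ∈ Submodule.span ℝ (σ : Set (Fin n → ℝ)) := Submodule.subset_span hv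
  rw [h, Submodule.mem_bot] at this
  rw [this]
  exact Submodule.zero_mem _

/-- A strongly convex cone of dimension at most one which contains a ray is that ray. -/
theorem eq_ray_of_ray_le {n : ℕ} {σ : Cone n} (hσ : IsStronglyConvex σ) {u : Lat n} (hu : u ≠ 0)
    (hle : ray u ≤ σ) (hd : coneDim σ ≤ 1) : σ = ray u := by
  have hmem : latToReal u ∈ Submodule.span ℝ (σ : Set (Fin n → ℝ)) :=
    Submodule.subset_span (hle (latToReal_mem_ray u))
  have hspan : Submodule.span ℝ {latToReal u} = Submodule.span ℝ (σ : Set (Fin n → ℝ)) := by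
    apply Submodule.eq_of_le_of_finrank_le
    · rw [Submodule.span_singleton_le_iff_mem]
      exact hmem
    · rw [finrank_span_singleton (latToReal_ne_zero hu)]
      exact hd
  refine le_antisymm (fun v hv => ?_) hle
  have hv' : v ∈ Submodule.span ℝ (σ : Set (Fin n → ℝ)) := Submodule.subset_span hv
  rw [← hspan, Submodule.mem_span_singleton] at hv'
  obtain ⟨r, rfl⟩ := hv'
  rcases le_or_gt 0 r with hr | hr
  · exact mem_ray.2 ⟨r, hr, rfl⟩
  · have h0 := hσ _ hv (hle (mem_ray.2 ⟨-r, by linarith, (neg_smul _ _).symm⟩))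
    rw [h0]
    exact Submodule.zero_mem _

/-- A cone contained in a ray is zero or the ray. -/
theorem eq_bot_or_eq_of_le_ray {n : ℕ} {σ : Cone n} {u : Lat n} (h : σ ≤ ray u) :
    σ = ⊥ ∨ σ = ray u := by
  by_cases h0 : σ = ⊥
  · exact Or.inl h0
  · right
    obtain ⟨v, hv, hv0⟩ := Submodule.exists_mem_ne_zero_of_ne_bot h0
    obtain ⟨r, hr, rfl⟩ := mem_ray.1 (h hv)
    have hr0 : r ≠ 0 := by rintro rfl; exact hv0 (zero_smul _ _)
    refine le_antisymm h fun x hx => ?_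
    obtain ⟨s, hs, rfl⟩ := mem_ray.1 hx
    have := σ.smul_mem (div_nonneg hs hr) hv
    rwa [smul_smul, div_mul_cancel₀ _ hr0] at this

theorem ray_injective {n : ℕ} {u v : Lat n} (hu : IsPrimitive u) (hv : IsPrimitive v)
    (h : ray u = ray v) : u = v := by
  have hmem : latToReal u ∈ ray v := h ▸ latToReal_mem_ray u
  obtain ⟨r, hr, hr'⟩ := mem_ray.1 hmem
  obtain ⟨m, hm⟩ := hv.exists_dual_eq_one
  have h1 : ((m u : ℤ) : ℝ) = r := by
    rw [← pairing_latToReal, hr', pairing_smul_right, pairing_latToReal, hm]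
    simp
  have h2 : u = m u • v := by
    apply latToReal_injective
    rw [hr', ← h1]
    ext i
    simp [latToReal]
  have h3 := hu _ _ h2
  have h4 : 0 ≤ m u := by
    have : (0 : ℝ) ≤ m u := h1 ▸ hr
    exact_mod_cast this
  rcases Int.isUnit_iff.1 h3 with h5 | h5
  · rw [h2, h5, one_smul]
  · omega

theorem bot_mem_cones {n : ℕ} (F : Fan n) {u : Lat n} (hu : IsPrimitive u)
    (h : ray u ∈ F.cones) : (⊥ : Cone n) ∈ F.cones := by
  obtain ⟨m, hm⟩ := hu.exists_dual_eq_one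
  refine F.face_mem _ h _ ⟨m, mem_dualMonoid_ray.2 (by omega), fun v => ?_⟩
  rw [Submodule.mem_bot]
  constructor
  · rintro rfl
    exact ⟨Submodule.zero_mem _, pairing_zero m⟩
  · rintro ⟨hv, h0⟩
    obtain ⟨r, -, rfl⟩ := mem_ray.1 hv
    rw [pairing_smul_right, pairing_latToReal, hm] at h0
    have : r = 0 := by simpa using h0
    rw [this, zero_smul]

/-- A cone of the fan contained in another one is a face of it. -/
theorem Fan.isFace_of_le {n : ℕ} (F : Fan n) {σ τ : Cone n} (hσ : σ ∈ F.cones)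
    (hτ : τ ∈ F.cones) (h : τ ≤ σ) : IsFace τ σ := by
  have := (F.inter_face σ hσ τ hτ).1
  rwa [inf_eq_right.2 h] at this

/-! ### Torus orbits -/

/-- The non-vanishing pattern of the monomials at the points of the orbit `O_σ ⊆ U_σ`. -/
def IsOrbitPoint {n : ℕ} {σ : Cone n} (x : AffineChart σ) : Prop :=
  ∀ m : dualMonoid σ, monomial m x ≠ 0 ↔ ∀ v ∈ σ, pairing m.1 v = 0

theorem ofChart_chartMap {n : ℕ} (F : Fan n) (σ τ : F.cones) (h : τ.1 ≤ σ.1)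
    (z : AffineChart τ.1) : ofChart F σ (chartMap h z) = ofChart F τ z :=
  Quotient.sound ⟨chartMap (le_inf h le_rfl) z, rfl, rfl⟩

theorem ofChart_eq_iff {n : ℕ} (F : Fan n) (σ τ : F.cones) (x : AffineChart σ.1)
    (y : AffineChart τ.1) : ofChart F σ x = ofChart F τ y ↔
      ∃ z : AffineChart (σ.1 ⊓ τ.1), chartMap inf_le_left z = x ∧ chartMap inf_le_right z = y :=
  Quotient.eq

/-- A chart containing a point of the orbit `O_τ` contains `U_τ`. -/
theorem IsOrbitPoint.le_and_eq {n : ℕ} {F : Fan n} {σ τ : F.cones} {y : AffineChart τ.1}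
    (hy : IsOrbitPoint y) {x : AffineChart σ.1} (h : ofChart F σ x = ofChart F τ y) :
    ∃ hle : τ.1 ≤ σ.1, x = chartMap hle y := by
  obtain ⟨z, rfl, rfl⟩ := (ofChart_eq_iff F σ τ x y).1 h
  obtain ⟨m, hm, hface⟩ := (F.inter_face σ.1 σ.2 τ.1 τ.2).2
  have hne := monomial_ne_zero hm hface z
  have hperp := (hy ⟨m, hm⟩).1 hne
  have hle : τ.1 ≤ σ.1 ⊓ τ.1 := fun v hv => (hface v).2 ⟨hv, hperp v hv⟩
  exact ⟨hle.trans inf_le_left, rfl⟩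

theorem ofChart_injective {n : ℕ} {F : Fan n} {τ : F.cones} {x y : AffineChart τ.1}
    (h : ofChart F τ x = ofChart F τ y) : x = y := by
  obtain ⟨z, rfl, rfl⟩ := (ofChart_eq_iff F τ τ x y).1 h
  rfl

theorem torusOrbit_disjoint {n : ℕ} {F : Fan n} {σ τ : F.cones} {p : ToricVariety F}
    (h : p ∈ torusOrbit F σ) (h' : p ∈ torusOrbit F τ) : σ = τ := by
  obtain ⟨x, rfl, hx⟩ := h
  obtain ⟨y, hy, hy'⟩ := h'
  exact Subtype.ext (le_antisymm (IsOrbitPoint.le_and_eq hx hy.symm).1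
    (IsOrbitPoint.le_and_eq hy' hy).1)

theorem monomial_ne_zero_of_perp {n : ℕ} {σ : Cone n} (m : dualMonoid σ)
    (hm : ∀ v ∈ σ, pairing m.1 v = 0) (x : AffineChart σ) : monomial m x ≠ 0 := by
  have hneg : -m.1 ∈ dualMonoid σ := fun v hv => by rw [pairing_neg, hm v hv, neg_zero]
  intro h
  have h1 := monomial_add m ⟨-m.1, hneg⟩ x
  have h2 : m + ⟨-m.1, hneg⟩ = 0 := Subtype.ext (add_neg_cancel m.1)
  rw [h2, monomial_zero, h, zero_mul] at h1
  exact one_ne_zero h1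

theorem pairing_eq_zero_of_mem_bot {n : ℕ} (m : DualLat n) {v : Fin n → ℝ}
    (hv : v ∈ (⊥ : Cone n)) : pairing m v = 0 := by
  rw [(Submodule.mem_bot _).1 hv, pairing_zero]

theorem isOrbitPoint_bot {n : ℕ} (x : AffineChart (⊥ : Cone n)) : IsOrbitPoint x := fun m =>
  ⟨fun _ _ hv => pairing_eq_zero_of_mem_bot m.1 hv,
    fun h => monomial_ne_zero_of_perp m h x⟩

/-- The toric variety is the union of its torus orbits. The cone of the orbit of `x ∈ U_σ` is cut out
by a monomial which does not vanish at `x` and is positive on as many generators of `σ` as possible. -/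
theorem exists_mem_torusOrbit {n : ℕ} (F : Fan n) (p : ToricVariety F) :
    ∃ τ : F.cones, p ∈ torusOrbit F τ := by
  induction p using Quotient.inductionOn with
  | h a =>
  obtain ⟨⟨σ, hσ⟩, x⟩ := a
  change ∃ τ : F.cones, ofChart F ⟨σ, hσ⟩ x ∈ torusOrbit F τ
  obtain ⟨s, hs⟩ := F.rational σ hσ
  have hdual : ∀ m : DualLat n, m ∈ dualMonoid σ ↔ ∀ u ∈ s, 0 ≤ m u := fun m => by
    rw [hs, mem_dualMonoid_hull]
  classical
  have hex : ∃ k : ℕ, ∃ m : dualMonoid σ, monomial m x ≠ 0 ∧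
      (s.filter fun u => m.1 u = 0).card = k :=
    ⟨_, 0, by rw [monomial_zero]; exact one_ne_zero, rfl⟩
  obtain ⟨m₀, hm₀, hk⟩ := Nat.find_spec hex
  have hmin : ∀ m : dualMonoid σ, monomial m x ≠ 0 → ∀ u ∈ s, m₀.1 u = 0 → m.1 u = 0 := by
    intro m hm u hu hu0
    by_contra hne
    have hlt : (s.filter fun u => (m₀ + m).1 u = 0).card < Nat.find hex := by
      rw [← hk]
      apply Finset.card_lt_card
      have hpos : ∀ m : dualMonoid σ, ∀ u ∈ s, 0 ≤ m.1 u := by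
        intro m u hu
        exact (hdual m.1).1 m.2 u hu
      refine (Finset.ssubset_iff_of_subset ?_).2 ⟨u, by simp [hu, hu0], ?_⟩
      · intro v hv
        simp only [Finset.mem_filter, AddSubmonoid.coe_add, LinearMap.add_apply] at hv ⊢
        have h1 := hpos m₀ v hv.1
        have h2 := hpos m v hv.1
        exact ⟨hv.1, by omega⟩
      · simp [hu0, hne]
    exact Nat.find_min hex hlt ⟨m₀ + m, by rw [monomial_add]; exact mul_ne_zero hm₀ hm, rfl⟩
  let τ : Cone n :=
    { carrier := {v | v ∈ σ ∧ pairing m₀.1 v = 0}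
      zero_mem' := ⟨σ.zero_mem, pairing_zero _⟩
      add_mem' := by
        rintro v w ⟨hv, hv'⟩ ⟨hw, hw'⟩
        refine ⟨σ.add_mem hv hw, ?_⟩
        have : pairing m₀.1 (v + w) = pairing m₀.1 v + pairing m₀.1 w := by
          simp [pairing, mul_add, Finset.sum_add_distrib]
        rw [this, hv', hw', add_zero]
      smul_mem' := by
        rintro ⟨r, hr⟩ v ⟨hv, hv'⟩
        refine ⟨σ.smul_mem hr hv, ?_⟩
        change pairing m₀.1 (r • v) = 0
        rw [pairing_smul_right, hv', mul_zero] }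
  have hτ : ∀ v, v ∈ τ ↔ v ∈ σ ∧ pairing m₀.1 v = 0 := fun v => Iff.rfl
  have hτF : τ ∈ F.cones := F.face_mem σ hσ τ ⟨m₀.1, m₀.2, hτ⟩
  obtain ⟨z, hz⟩ := exists_chart_lift ⟨s, hs⟩ m₀.2 hτ x hm₀
  refine ⟨⟨τ, hτF⟩, z, ?_, fun m => ⟨fun hne => ?_, fun hperp => ?_⟩⟩
  · rw [← ofChart_chartMap F ⟨σ, hσ⟩ ⟨τ, hτF⟩ (face_le hτ) z, hz]
  · obtain ⟨k, hk⟩ := exists_add_nsmul_mem ⟨s, hs⟩ m₀.2 hτ m.2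
    have h1 : monomial ⟨_, hk⟩ x ≠ 0 := by
      have e : monomial ⟨_, hk⟩ x = monomial m z * monomial m₀ x ^ k := by
        rw [← hz, monomial_chartMap, monomial_chartMap, ← monomial_nsmul, ← monomial_add]
        rfl
      rw [e]
      exact mul_ne_zero hne (pow_ne_zero _ hm₀)
    have h2 := hmin _ h1
    -- a monomial bounded by a multiple of `m₀` vanishes where `m₀` does
    have h3 : ∃ l : ℕ, l • m₀.1 - (m.1 + k • m₀.1) ∈ dualMonoid σ := by
      refine ⟨∑ u ∈ s, ((m.1 + k • m₀.1) u).natAbs, ?_⟩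
      have hm₀' := (hdual m₀.1).1 m₀.2
      rw [hdual]
      intro u hu
      rw [LinearMap.sub_apply, LinearMap.smul_apply]
      rcases (hm₀' u hu).eq_or_lt with h0 | h0
      · have := h2 u hu h0.symm
        simp only at this
        rw [this, ← h0]
        simp
      · have h5 : ((m.1 + k • m₀.1) u).natAbs ≤ ∑ u ∈ s, ((m.1 + k • m₀.1) u).natAbs :=
          Finset.single_le_sum (f := fun u => ((m.1 + k • m₀.1) u).natAbs)
            (fun _ _ => Nat.zero_le _) hu
        generalize (∑ u ∈ s, ((m.1 + k • m₀.1) u).natAbs) = N at h5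
        have h6 : (m.1 + k • m₀.1) u ≤ N := by omega
        rw [nsmul_eq_mul]
        nlinarith
    obtain ⟨l, hl⟩ := h3
    intro v hv
    have h7 := hl v hv.1
    have h8 := m.2 v hv
    rw [sub_eq_add_neg, pairing_add, pairing_neg, pairing_nsmul, pairing_add, pairing_nsmul,
      hv.2] at h7
    linarith
  · exact monomial_ne_zero_of_perp m hperp z

/-! ### Maps given by products of powers of linear forms -/

/-- The linear form `x ↦ v₁ x₀ - v₀ x₁` on `ℂ²` vanishing at `v`. -/
def lform (v x : Fin 2 → ℂ) : ℂ := v 1 * x 0 - v 0 * x 1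

/-- `lform v` as a polynomial. -/
noncomputable def lpoly (v : Fin 2 → ℂ) : MvPolynomial (Fin 2) ℂ :=
  MvPolynomial.C (v 1) * MvPolynomial.X 0 - MvPolynomial.C (v 0) * MvPolynomial.X 1

theorem eval_lpoly (v x : Fin 2 → ℂ) : MvPolynomial.eval x (lpoly v) = lform v x := by
  simp [lpoly, lform]

theorem lpoly_isHomogeneous (v : Fin 2 → ℂ) : (lpoly v).IsHomogeneous 1 := by
  refine MvPolynomial.IsHomogeneous.sub ?_ ?_
  · simpa using (MvPolynomial.isHomogeneous_C (Fin 2) (v 1)).mul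
      (MvPolynomial.isHomogeneous_X ℂ (0 : Fin 2))
  · simpa using (MvPolynomial.isHomogeneous_C (Fin 2) (v 0)).mul
      (MvPolynomial.isHomogeneous_X ℂ (1 : Fin 2))

theorem lform_self (v : Fin 2 → ℂ) : lform v v = 0 := by
  rw [lform]; ring

theorem lform_smul_right (v x : Fin 2 → ℂ) (c : ℂ) : lform v (c • x) = c * lform v x := by
  simp [lform]; ring

theorem lform_smul_left (v x : Fin 2 → ℂ) (c : ℂ) : lform (c • v) x = c * lform v x := by
  simp [lform]; ring

theorem lform_swap (v x : Fin 2 → ℂ) : lform v x = - lform x v := by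
  rw [lform, lform]; ring

/-- The multiplicative form of Cramer's rule in the plane. -/
theorem lform_smul_eq (v w x : Fin 2 → ℂ) :
    lform v w • x = lform x w • v + lform v x • w := by
  ext i
  fin_cases i <;> simp [lform] <;> ring

theorem exists_smul_eq_of_lform_eq_zero {v x : Fin 2 → ℂ} (hv : v ≠ 0) (hx : x ≠ 0)
    (h : lform v x = 0) : ∃ c : ℂ, c ≠ 0 ∧ x = c • v := by
  have h' : v 1 * x 0 = v 0 * x 1 := sub_eq_zero.1 h
  have key : ∃ c : ℂ, x = c • v := by
    by_cases h0 : v 0 = 0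
    · have h1 : v 1 ≠ 0 := fun h1 => hv (by ext i; fin_cases i <;> simp [h0, h1])
      rw [h0, zero_mul] at h'
      have hx0 : x 0 = 0 := (mul_eq_zero.1 h').resolve_left h1
      refine ⟨x 1 / v 1, ?_⟩
      ext i
      fin_cases i
      · simp [hx0, h0]
      · simp [h1]
    · refine ⟨x 0 / v 0, ?_⟩
      ext i
      fin_cases i
      · simp [h0]
      · simp only [Fin.mk_one, Pi.smul_apply, smul_eq_mul]
        field_simp
        linear_combination -h'
  obtain ⟨c, hc⟩ := key
  exact ⟨c, by rintro rfl; exact hx (by rw [hc, zero_smul]), hc⟩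

theorem lform_rep_eq_zero_iff {v : Fin 2 → ℂ} (hv : v ≠ 0) (q : P1) :
    lform v q.rep = 0 ↔ q = Projectivization.mk ℂ v hv := by
  constructor
  · intro h
    obtain ⟨c, hc, h'⟩ := exists_smul_eq_of_lform_eq_zero hv q.rep_nonzero h
    rw [← q.mk_rep, Projectivization.mk_eq_mk_iff]
    exact ⟨Units.mk0 c hc, h'.symm⟩
  · rintro rfl
    obtain ⟨c, hc⟩ := Projectivization.exists_smul_eq_mk_rep ℂ v hv
    rw [← hc, Units.smul_def, lform_smul_right, lform_self, mul_zero]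

/-- An automorphism of `ℂ²` scales `lform` by its determinant. -/
theorem exists_lform_smul (g : LinearMap.GeneralLinearGroup ℂ (Fin 2 → ℂ)) :
    ∃ D : ℂ, D ≠ 0 ∧ ∀ v x, lform (g • v) (g • x) = D * lform v x := by
  have key : ∀ g : LinearMap.GeneralLinearGroup ℂ (Fin 2 → ℂ), ∀ v x,
      lform (g • v) (g • x) = lform (g • Pi.single 1 1) (g • Pi.single 0 1) * lform v x := by
    intro g v x
    have hdec : ∀ y : Fin 2 → ℂ, g • y = y 0 • (g • (Pi.single 0 1 : Fin 2 → ℂ))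
        + y 1 • (g • (Pi.single 1 1 : Fin 2 → ℂ)) := by
      intro y
      rw [← smul_comm g (y 0), ← smul_comm g (y 1), ← smul_add]
      congr 1
      ext i
      fin_cases i <;> simp
    rw [hdec v, hdec x]
    simp only [lform, Pi.add_apply, Pi.smul_apply, smul_eq_mul]
    ring
  refine ⟨_, ?_, key g⟩
  intro h0
  have h1 := key g⁻¹ (g • Pi.single 1 1) (g • Pi.single 0 1)
  rw [inv_smul_smul, inv_smul_smul, h0, mul_zero] at h1
  simp [lform] at h1

/-- The vectors `v_i` are nonzero and define pairwise distinct points of the projective line. -/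
def PairwiseIndep {a : ℕ} (v : Fin a → Fin 2 → ℂ) : Prop :=
  (∀ i, v i ≠ 0) ∧ ∀ i j, lform (v i) (v j) = 0 → i = j

theorem PairwiseIndep.eq_of_lform_eq_zero {a : ℕ} {v : Fin a → Fin 2 → ℂ} (hv : PairwiseIndep v)
    {x : Fin 2 → ℂ} (hx : x ≠ 0) {i j : Fin a} (hi : lform (v i) x = 0) (hj : lform (v j) x = 0) :
    i = j := by
  obtain ⟨c, hc, rfl⟩ := exists_smul_eq_of_lform_eq_zero (hv.1 i) hx hi
  rw [lform_smul_right] at hj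
  exact (hv.2 j i ((mul_eq_zero.1 hj).resolve_left hc)).symm

/-- The points of the projective line with real coordinates `(r, 1)` avoid any finite set, for all but
finitely many `r`. -/
theorem eventually_lform_real_ne_zero {a : ℕ} {v : Fin a → Fin 2 → ℂ} (hv : ∀ i, v i ≠ 0) :
    ∀ᶠ r : ℝ in cofinite, ∀ i, lform (v i) ![(r : ℂ), 1] ≠ 0 := by
  rw [eventually_all]
  intro i
  apply Set.Subsingleton.finite
  intro r hr s hs
  simp only [lform, Matrix.cons_val_zero, Matrix.cons_val_one, mul_one, Set.mem_compl_iff,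
    Set.mem_ofPred_eq, not_not] at hr hs
  by_cases h1 : v i 1 = 0
  · exfalso
    apply hv i
    ext j
    fin_cases j
    · simpa [h1] using hr
    · simpa using h1
  · have : v i 1 * (r : ℂ) = v i 1 * (s : ℂ) := by linear_combination hr - hs
    exact_mod_cast mul_left_cancel₀ h1 this

theorem vec_real_ne_zero (r : ℝ) : (![(r : ℂ), 1] : Fin 2 → ℂ) ≠ 0 := fun h => by
  simpa using congrFun h 1

/-- The product `∏ᵢ ℓᵢ(x) ^ (wᵢ ⟨m, uᵢ⟩)`, where `ℓᵢ` is the linear form vanishing at `vᵢ`. If the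
exponents of the forms vanishing at `x` are non-negative, the convention `0 ^ 0 = 1` makes this the value
of the corresponding rational function also at the points `vᵢ`. -/
noncomputable def formVal {n a : ℕ} (u : Fin a → Lat n) (w : Fin a → ℕ) (v : Fin a → Fin 2 → ℂ)
    (m : DualLat n) (x : Fin 2 → ℂ) : ℂ :=
  ∏ i, lform (v i) x ^ ((w i : ℤ) * m (u i))

/-- The cone `σ` contains all `u_i` for which the linear form of `v_i` vanishes at `x`. -/
def Supports {n a : ℕ} (u : Fin a → Lat n) (v : Fin a → Fin 2 → ℂ) (x : Fin 2 → ℂ)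
    (σ : Cone n) : Prop :=
  ∀ i, lform (v i) x = 0 → latToReal (u i) ∈ σ

/-- The map `φ` is given in the affine charts of the toric variety by `z^m = c_m ∏ᵢ ℓᵢ ^ (wᵢ ⟨m, uᵢ⟩)`,
where `ℓᵢ` is the linear form vanishing at `vᵢ`. At a point `x` the formula is imposed in all charts `U_σ`
such that `σ` contains the `uᵢ` with `ℓᵢ(x) = 0`; then no `z^m` with `m ∈ σ^∨` has a pole at `x`. -/
def HasMonomialForm {n a : ℕ} (F : Fan n) (u : Fin a → Lat n) (w : Fin a → ℕ)
    (c : DualLat n → ℂ) (v : Fin a → Fin 2 → ℂ) (φ : P1 → ToricVariety F) : Prop :=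
  ∀ (x : Fin 2 → ℂ) (hx : x ≠ 0) (σ : F.cones), Supports u v x σ.1 →
    ∃ y : AffineChart σ.1, φ (Projectivization.mk ℂ x hx) = ofChart F σ y ∧
      ∀ m : dualMonoid σ.1, monomial m y = c m.1 * formVal u w v m.1 x

theorem sum_weights_eq_zero {n a : ℕ} {u : Fin a → Lat n} {w : Fin a → ℕ}
    (hbal : ∑ i, w i • u i = 0) (m : DualLat n) : ∑ i, (w i : ℤ) * m (u i) = 0 := by
  have := congrArg m hbal
  simp only [map_sum, map_nsmul, map_zero] at this
  simpa only [nsmul_eq_mul] using this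

/-- By the balancing condition, the product over the divisors is homogeneous of degree zero. -/
theorem formVal_prod_smul {n a : ℕ} {u : Fin a → Lat n} {w : Fin a → ℕ}
    (hbal : ∑ i, w i • u i = 0) (m : DualLat n) {c : ℂ} (hc : c ≠ 0) (f : Fin a → ℂ) :
    ∏ i, (c * f i) ^ ((w i : ℤ) * m (u i)) = ∏ i, f i ^ ((w i : ℤ) * m (u i)) := by
  simp_rw [mul_zpow]
  rw [Finset.prod_mul_distrib]
  have : ∏ i, c ^ ((w i : ℤ) * m (u i)) = c ^ (∑ i, (w i : ℤ) * m (u i)) := by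
    induction (Finset.univ : Finset (Fin a)) using Finset.induction_on with
    | empty => simp
    | insert i s hi ih => rw [Finset.prod_insert hi, Finset.sum_insert hi, ih, zpow_add₀ hc]
  rw [this, sum_weights_eq_zero hbal, zpow_zero, one_mul]

theorem formVal_smul {n a : ℕ} {u : Fin a → Lat n} {w : Fin a → ℕ} (hbal : ∑ i, w i • u i = 0)
    (v : Fin a → Fin 2 → ℂ) (m : DualLat n) {c : ℂ} (hc : c ≠ 0) (x : Fin 2 → ℂ) :
    formVal u w v m (c • x) = formVal u w v m x := by
  simp only [formVal, lform_smul_right]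
  exact formVal_prod_smul hbal m hc _

theorem formVal_ne_zero {n a : ℕ} {u : Fin a → Lat n} {w : Fin a → ℕ} {v : Fin a → Fin 2 → ℂ}
    (m : DualLat n) {x : Fin 2 → ℂ} (hx : ∀ i, lform (v i) x = 0 → m (u i) = 0) :
    formVal u w v m x ≠ 0 := by
  refine Finset.prod_ne_zero_iff.2 fun i _ => ?_
  by_cases h : lform (v i) x = 0
  · rw [hx i h, mul_zero, zpow_zero]
    exact one_ne_zero
  · exact zpow_ne_zero _ h

theorem formVal_zero {n a : ℕ} (u : Fin a → Lat n) (w : Fin a → ℕ) (v : Fin a → Fin 2 → ℂ)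
    (x : Fin 2 → ℂ) : formVal u w v 0 x = 1 := by
  simp [formVal]

theorem formVal_add {n a : ℕ} {u : Fin a → Lat n} {w : Fin a → ℕ} {v : Fin a → Fin 2 → ℂ}
    {m m' : DualLat n} {x : Fin 2 → ℂ} (hw : ∀ i, 0 < w i)
    (hm : ∀ i, lform (v i) x = 0 → 0 ≤ m (u i)) (hm' : ∀ i, lform (v i) x = 0 → 0 ≤ m' (u i)) :
    formVal u w v (m + m') x = formVal u w v m x * formVal u w v m' x := by
  simp only [formVal, ← Finset.prod_mul_distrib]
  refine Finset.prod_congr rfl fun i _ => ?_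
  rw [LinearMap.add_apply, mul_add]
  by_cases h : lform (v i) x = 0
  · rw [h]
    have hwi : (0 : ℤ) < w i := by exact_mod_cast hw i
    obtain ⟨k, hk⟩ := Int.eq_ofNat_of_zero_le (mul_nonneg hwi.le (hm i h))
    obtain ⟨l, hl⟩ := Int.eq_ofNat_of_zero_le (mul_nonneg hwi.le (hm' i h))
    rw [hk, hl, ← Nat.cast_add, zpow_natCast, zpow_natCast, zpow_natCast, pow_add]
  · exact zpow_add₀ h _ _

theorem Supports.dual_nonneg {n a : ℕ} {u : Fin a → Lat n} {v : Fin a → Fin 2 → ℂ}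
    {x : Fin 2 → ℂ} {σ : Cone n} (h : Supports u v x σ) (m : dualMonoid σ) (i : Fin a)
    (hi : lform (v i) x = 0) : 0 ≤ m.1 (u i) :=
  ToricLines.dual_nonneg m.2 (h i hi)

theorem supports_of_forall_ne_zero {n a : ℕ} {u : Fin a → Lat n} {v : Fin a → Fin 2 → ℂ}
    {x : Fin 2 → ℂ} (h : ∀ i, lform (v i) x ≠ 0) (σ : Cone n) : Supports u v x σ :=
  fun i hi => absurd hi (h i)

theorem supports_ray {n a : ℕ} {u : Fin a → Lat n} {v : Fin a → Fin 2 → ℂ}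
    (hv : PairwiseIndep v) {x : Fin 2 → ℂ} (hx : x ≠ 0) {i : Fin a} (hi : lform (v i) x = 0) :
    Supports u v x (ray (u i)) := fun j hj => by
  rw [← hv.eq_of_lform_eq_zero hx hi hj]
  exact latToReal_mem_ray _

/-- Among the cones supporting the formula at `x` there is a smallest one: zero or a ray. -/
theorem exists_minimal_supports {n a : ℕ} {F : Fan n} {u : Fin a → Lat n}
    (hbot : ⊥ ∈ F.cones) (hray : ∀ i, ray (u i) ∈ F.cones) {v : Fin a → Fin 2 → ℂ}
    (hv : PairwiseIndep v) {x : Fin 2 → ℂ} (hx : x ≠ 0) :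
    ∃ τ : F.cones, Supports u v x τ.1 ∧ (∀ σ : Cone n, Supports u v x σ → τ.1 ≤ σ) ∧
      (((∀ i, lform (v i) x ≠ 0) ∧ τ.1 = ⊥) ∨ ∃ i, lform (v i) x = 0 ∧ τ.1 = ray (u i)) := by
  by_cases h : ∀ i, lform (v i) x ≠ 0
  · exact ⟨⟨⊥, hbot⟩, supports_of_forall_ne_zero h _, fun σ _ => bot_le, Or.inl ⟨h, rfl⟩⟩
  · push Not at h
    obtain ⟨i, hi⟩ := h
    refine ⟨⟨ray (u i), hray i⟩, supports_ray hv hx hi, fun σ hσ => ?_, Or.inr ⟨i, hi, rfl⟩⟩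
    change ray (u i) ≤ σ
    rw [ray, PointedCone.hull, Submodule.span_singleton_le_iff_mem]
    exact hσ i hi

/-- The monomials prescribed by a multiplicative family of coefficients form a map. -/
theorem exists_hasMonomialForm {n a : ℕ} {F : Fan n} {u : Fin a → Lat n} {w : Fin a → ℕ}
    (hw : ∀ i, 0 < w i) (hbal : ∑ i, w i • u i = 0)
    (hbot : ⊥ ∈ F.cones) (hray : ∀ i, ray (u i) ∈ F.cones) {v : Fin a → Fin 2 → ℂ}
    (hv : PairwiseIndep v) {c : DualLat n → ℂ} (hc0 : c 0 = 1)
    (hc : ∀ m m', c (m + m') = c m * c m') :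
    ∃ φ : P1 → ToricVariety F, HasMonomialForm F u w c v φ := by
  have key : ∀ q : P1, ∃ z : ToricVariety F, ∀ (x : Fin 2 → ℂ) (hx : x ≠ 0),
      Projectivization.mk ℂ x hx = q → ∀ σ : F.cones, Supports u v x σ.1 →
      ∃ y : AffineChart σ.1, z = ofChart F σ y ∧
        ∀ m : dualMonoid σ.1, monomial m y = c m.1 * formVal u w v m.1 x := by
    intro q
    obtain ⟨τ, hτ, hmin, -⟩ := exists_minimal_supports hbot hray hv q.rep_nonzero
    let y : AffineChart τ.1 :=
      { toFun := fun m => c m.toAdd.1 * formVal u w v m.toAdd.1 q.rep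
        map_one' := by
          change c 0 * formVal u w v 0 q.rep = 1
          rw [hc0, formVal_zero, one_mul]
        map_mul' := fun m m' => by
          change c (m.toAdd.1 + m'.toAdd.1) * formVal u w v (m.toAdd.1 + m'.toAdd.1) q.rep = _
          rw [hc, formVal_add hw (fun i hi => hτ.dual_nonneg m.toAdd i hi)
            (fun i hi => hτ.dual_nonneg m'.toAdd i hi)]
          ring }
    refine ⟨ofChart F τ y, fun x hx hxq σ hσ => ?_⟩
    obtain ⟨b, hb⟩ : ∃ b : ℂ, b ≠ 0 ∧ q.rep = b • x := by
      subst hxq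
      obtain ⟨b, hb⟩ := Projectivization.exists_smul_eq_mk_rep ℂ x hx
      exact ⟨b, b.ne_zero, hb.symm⟩
    have hσ' : Supports u v q.rep σ.1 := fun i hi => hσ i (by
      rw [hb.2, lform_smul_right] at hi
      exact (mul_eq_zero.1 hi).resolve_left hb.1)
    have hle := hmin σ.1 hσ'
    refine ⟨chartMap hle y, (ofChart_chartMap F σ τ hle y).symm, fun m => ?_⟩
    rw [monomial_chartMap]
    change c m.1 * formVal u w v m.1 q.rep = _
    rw [hb.2, formVal_smul hbal v m.1 hb.1]
  choose φ hφ using key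
  exact ⟨φ, fun x hx σ hσ => hφ _ x hx rfl σ hσ⟩

/-- A map in monomial form is determined by the coefficients and the points. -/
theorem HasMonomialForm.unique {n a : ℕ} {F : Fan n} {u : Fin a → Lat n} {w : Fin a → ℕ}
    (hbot : ⊥ ∈ F.cones) (hray : ∀ i, ray (u i) ∈ F.cones) {v : Fin a → Fin 2 → ℂ}
    (hv : PairwiseIndep v) {c : DualLat n → ℂ} {φ ψ : P1 → ToricVariety F}
    (hφ : HasMonomialForm F u w c v φ) (hψ : HasMonomialForm F u w c v ψ) : φ = ψ := by
  ext q
  induction q using Projectivization.ind with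
  | h x hx =>
  obtain ⟨τ, hτ, -, -⟩ := exists_minimal_supports hbot hray hv hx
  obtain ⟨y, hy, hy'⟩ := hφ x hx τ hτ
  obtain ⟨z, hz, hz'⟩ := hψ x hx τ hτ
  rw [hy, hz, chart_ext fun m => (hy' m).trans (hz' m).symm]

/-- The coefficients are determined by the map, as can be seen at any point of the big torus. -/
theorem HasMonomialForm.coeff_unique {n a : ℕ} {F : Fan n} {u : Fin a → Lat n} {w : Fin a → ℕ}
    (hbot : ⊥ ∈ F.cones) {v : Fin a → Fin 2 → ℂ} (hv : PairwiseIndep v) {c c' : DualLat n → ℂ}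
    {φ : P1 → ToricVariety F} (hφ : HasMonomialForm F u w c v φ)
    (hφ' : HasMonomialForm F u w c' v φ) : c = c' := by
  obtain ⟨r, hr⟩ := (eventually_lform_real_ne_zero hv.1).exists
  ext m
  have hs := supports_of_forall_ne_zero (u := u) hr (⊥ : Cone n)
  obtain ⟨y, hy, hy'⟩ := hφ _ (vec_real_ne_zero r) ⟨⊥, hbot⟩ hs
  obtain ⟨z, hz, hz'⟩ := hφ' _ (vec_real_ne_zero r) ⟨⊥, hbot⟩ hs
  have hyz : y = z := ofChart_injective (hy.symm.trans hz)
  subst hyz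
  have h1 := (hy' ⟨m, mem_dualMonoid_bot m⟩).symm.trans (hz' ⟨m, mem_dualMonoid_bot m⟩)
  exact mul_right_cancel₀ (formVal_ne_zero m fun i hi => absurd hi (hr i)) h1

/-- Reparametrization of a map in monomial form by `g`. The determinant of `g` does not contribute, by
the balancing condition; the scalars `b_i` relating the points do. -/
theorem HasMonomialForm.comp_smul {n a : ℕ} {F : Fan n} {u : Fin a → Lat n} {w : Fin a → ℕ}
    (hbal : ∑ i, w i • u i = 0) {v v' : Fin a → Fin 2 → ℂ} {c : DualLat n → ℂ}
    {φ : P1 → ToricVariety F} (hφ : HasMonomialForm F u w c v φ)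
    (g : LinearMap.GeneralLinearGroup ℂ (Fin 2 → ℂ)) {b : Fin a → ℂ} (hb : ∀ i, b i ≠ 0)
    (hg : ∀ i, g • v' i = b i • v i) :
    HasMonomialForm F u w (fun m => c m * ∏ i, (b i)⁻¹ ^ ((w i : ℤ) * m (u i))) v'
      (fun q => φ (g • q)) := by
  obtain ⟨D, hD, hDg⟩ := exists_lform_smul g
  have hform : ∀ i x, lform (v i) (g • x) = D * ((b i)⁻¹ * lform (v' i) x) := by
    intro i x
    have := hDg (v' i) x
    rw [hg, lform_smul_left] at this
    have hbi := hb i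
    field_simp
    linear_combination this
  intro x hx σ hσ
  have hgx : g • x ≠ 0 := (smul_ne_zero_iff_ne g).2 hx
  obtain ⟨y, hy, hy'⟩ := hφ (g • x) hgx σ (fun i hi => hσ i (by
    rw [hform] at hi
    exact (mul_eq_zero.1 ((mul_eq_zero.1 hi).resolve_left hD)).resolve_left (inv_ne_zero (hb i))))
  refine ⟨y, hy, fun m => ?_⟩
  rw [hy' m]
  simp only [formVal, hform]
  rw [formVal_prod_smul hbal m.1 hD, mul_assoc, ← Finset.prod_mul_distrib]
  simp only [mul_zpow]

theorem HasMonomialForm.torusTranslate {n a : ℕ} {F : Fan n} {u : Fin a → Lat n} {w : Fin a → ℕ}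
    {v : Fin a → Fin 2 → ℂ} {c : DualLat n → ℂ} {φ : P1 → ToricVariety F}
    (hφ : HasMonomialForm F u w c v φ) (t : RealTorus n) :
    HasMonomialForm F u w (fun m => ((torusChar m t : ℝˣ) : ℝ) * c m) v
      (fun q => torusTranslate F t (φ q)) := by
  intro x hx σ hσ
  obtain ⟨y, hy, hy'⟩ := hφ x hx σ hσ
  refine ⟨chartTranslate t σ.1 y, ?_, fun m => ?_⟩
  · simp only [hy]
    rfl
  · rw [mul_assoc, ← hy' m]
    rfl

/-! ### Maps in monomial form are lines -/

theorem NearPoint.mono {p : P1} {T T' : P1 → Prop} (h : NearPoint p T) (hT : ∀ q, T q → T' q) :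
    NearPoint p T' := by
  obtain ⟨d, R, hR, hp, hq⟩ := h
  exact ⟨d, R, hR, hp, fun q hq' => hT q (hq q hq')⟩

theorem eval_smul_of_isHomogeneous {d : ℕ} {P : MvPolynomial (Fin 2) ℂ} (hP : P.IsHomogeneous d)
    (c : ℂ) (x : Fin 2 → ℂ) :
    MvPolynomial.eval (c • x) P = c ^ d * MvPolynomial.eval x P := by
  rw [MvPolynomial.eval_eq, MvPolynomial.eval_eq, Finset.mul_sum]
  refine Finset.sum_congr rfl fun e he => ?_
  have hd : ∑ i, e i = d := by
    have := hP (MvPolynomial.mem_support_iff.1 he)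
    rw [Finsupp.weight_apply, Finsupp.sum_fintype _ _ (by simp)] at this
    simpa using this
  have hsupp : ∏ i ∈ e.support, c ^ e i = c ^ d := by
    rw [Finset.prod_pow_eq_pow_sum, ← hd]
    congr 1
    exact Finset.sum_subset (Finset.subset_univ _) fun i _ hi => Finsupp.notMem_support_iff.1 hi
  simp only [Pi.smul_apply, smul_eq_mul, mul_pow, Finset.prod_mul_distrib, hsupp]
  ring

theorem lform_mk_rep {v : Fin 2 → ℂ} (hv : v ≠ 0) :
    lform v (Projectivization.mk ℂ v hv).rep = 0 :=
  (lform_rep_eq_zero_iff hv _).2 rfl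

theorem nearPoint_supports {n a : ℕ} {u : Fin a → Lat n} {v : Fin a → Fin 2 → ℂ} {p : P1}
    {σ : Cone n} (hσ : Supports u v p.rep σ) : NearPoint p (fun q => Supports u v q.rep σ) := by
  classical
  refine ⟨_, ∏ i ∈ Finset.univ.filter (fun i => lform (v i) p.rep ≠ 0), lpoly (v i),
    MvPolynomial.IsHomogeneous.prod _ _ _ fun i _ => lpoly_isHomogeneous (v i), ?_, ?_⟩
  · rw [evalAt, map_prod, Finset.prod_ne_zero_iff]
    intro i hi
    rw [eval_lpoly]
    exact (Finset.mem_filter.1 hi).2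
  · intro q hq i hi
    rw [evalAt, map_prod, Finset.prod_ne_zero_iff] at hq
    refine hσ i ?_
    by_contra h
    have := hq i (Finset.mem_filter.2 ⟨Finset.mem_univ i, h⟩)
    rw [eval_lpoly] at this
    exact this hi

theorem zpow_eq_pow_div_pow (x : ℂ) (e : ℤ) : x ^ e = x ^ e.toNat / x ^ (-e).toNat := by
  rcases le_total 0 e with h | h
  · obtain ⟨k, rfl⟩ := Int.eq_ofNat_of_zero_le h
    simp
  · obtain ⟨k, hk⟩ := Int.eq_ofNat_of_zero_le (neg_nonneg.2 h)
    obtain rfl : e = -k := by omega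
    simp

theorem sum_toNat_eq {ι : Type*} (s : Finset ι) (e : ι → ℤ) :
    ((∑ i ∈ s, (e i).toNat : ℕ) : ℤ) = ((∑ i ∈ s, (-e i).toNat : ℕ) : ℤ) + ∑ i ∈ s, e i := by
  push_cast
  rw [← Finset.sum_add_distrib]
  refine Finset.sum_congr rfl fun i _ => ?_
  omega

/-- The product `∏ᵢ ℓᵢ ^ kᵢ` as a polynomial. -/
noncomputable def formPoly {a : ℕ} (s : Finset (Fin a)) (v : Fin a → Fin 2 → ℂ) (k : Fin a → ℕ) :
    MvPolynomial (Fin 2) ℂ := ∏ i ∈ s, lpoly (v i) ^ k i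

theorem formPoly_isHomogeneous {a : ℕ} (s : Finset (Fin a)) (v : Fin a → Fin 2 → ℂ)
    (k : Fin a → ℕ) : (formPoly s v k).IsHomogeneous (∑ i ∈ s, k i) := by
  refine MvPolynomial.IsHomogeneous.prod _ _ _ fun i _ => ?_
  simpa using (lpoly_isHomogeneous (v i)).pow (k i)

theorem eval_formPoly {a : ℕ} (s : Finset (Fin a)) (v : Fin a → Fin 2 → ℂ) (k : Fin a → ℕ)
    (x : Fin 2 → ℂ) :
    MvPolynomial.eval x (formPoly s v k) = ∏ i ∈ s, lform (v i) x ^ k i := by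
  simp only [formPoly, map_prod, map_pow, eval_lpoly]

theorem prod_zpow_eq_div {a : ℕ} (s : Finset (Fin a)) (v : Fin a → Fin 2 → ℂ) (e : Fin a → ℤ)
    (x : Fin 2 → ℂ) : ∏ i ∈ s, lform (v i) x ^ e i =
      MvPolynomial.eval x (formPoly s v fun i => (e i).toNat) /
        MvPolynomial.eval x (formPoly s v fun i => (-e i).toNat) := by
  rw [eval_formPoly, eval_formPoly, ← Finset.prod_div_distrib]
  exact Finset.prod_congr rfl fun i _ => zpow_eq_pow_div_pow _ _

theorem eval_formPoly_ne_zero {a : ℕ} {s : Finset (Fin a)} {v : Fin a → Fin 2 → ℂ} {k : Fin a → ℕ}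
    {x : Fin 2 → ℂ} (h : ∀ i ∈ s, lform (v i) x = 0 → k i = 0) :
    MvPolynomial.eval x (formPoly s v k) ≠ 0 := by
  rw [eval_formPoly, Finset.prod_ne_zero_iff]
  intro i hi
  by_cases h0 : lform (v i) x = 0
  · rw [h i hi h0, pow_zero]
    exact one_ne_zero
  · exact pow_ne_zero _ h0

/-- The maps to a fixed chart `U_σ`, extended by an arbitrary value to the points where the formula has
no meaning in `U_σ`. -/
theorem HasMonomialForm.exists_chart {n a : ℕ} {F : Fan n} {u : Fin a → Lat n} {w : Fin a → ℕ}
    {v : Fin a → Fin 2 → ℂ} {c : DualLat n → ℂ} {φ : P1 → ToricVariety F}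
    (hφ : HasMonomialForm F u w c v φ) (σ : F.cones) : ∃ x : P1 → AffineChart σ.1,
      ∀ q, Supports u v q.rep σ.1 → φ q = ofChart F σ (x q) ∧
        ∀ m : dualMonoid σ.1, monomial m (x q) = c m.1 * formVal u w v m.1 q.rep := by
  have : ∀ q : P1, ∃ y : AffineChart σ.1, Supports u v q.rep σ.1 → φ q = ofChart F σ y ∧
        ∀ m : dualMonoid σ.1, monomial m y = c m.1 * formVal u w v m.1 q.rep := by
    intro q
    by_cases h : Supports u v q.rep σ.1
    · obtain ⟨y, hy⟩ := hφ q.rep q.rep_nonzero σ h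
      rw [q.mk_rep] at hy
      exact ⟨y, fun _ => hy⟩
    · exact ⟨1, fun h' => absurd h' h⟩
  choose x hx using this
  exact ⟨x, hx⟩

theorem HasMonomialForm.isMorphism {n a : ℕ} {F : Fan n} {u : Fin a → Lat n} {w : Fin a → ℕ}
    (hbal : ∑ i, w i • u i = 0) (hbot : ⊥ ∈ F.cones) (hray : ∀ i, ray (u i) ∈ F.cones)
    {v : Fin a → Fin 2 → ℂ} (hv : PairwiseIndep v) {c : DualLat n → ℂ} {φ : P1 → ToricVariety F}
    (hφ : HasMonomialForm F u w c v φ) : IsMorphism F φ := by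
  intro p
  obtain ⟨τ, hτ, -, -⟩ := exists_minimal_supports hbot hray hv p.rep_nonzero
  obtain ⟨x, hx⟩ := hφ.exists_chart τ
  refine ⟨τ, x, (nearPoint_supports hτ).mono fun q hq => (hx q hq).1, fun m => ?_⟩
  have hdeg := sum_toNat_eq Finset.univ fun i => (w i : ℤ) * m.1 (u i)
  rw [sum_weights_eq_zero hbal, add_zero, Nat.cast_inj] at hdeg
  refine ⟨_, MvPolynomial.C (c m.1) * formPoly Finset.univ v fun i => ((w i : ℤ) * m.1 (u i)).toNat,
    formPoly Finset.univ v fun i => (-((w i : ℤ) * m.1 (u i))).toNat, ?_,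
    formPoly_isHomogeneous _ _ _, ?_, (nearPoint_supports hτ).mono fun q hq => ?_⟩
  · rw [← hdeg]
    simpa using (MvPolynomial.isHomogeneous_C (Fin 2) (c m.1)).mul
      (formPoly_isHomogeneous Finset.univ v fun i => ((w i : ℤ) * m.1 (u i)).toNat)
  · refine eval_formPoly_ne_zero fun i _ hi => ?_
    have := mul_nonneg (Int.natCast_nonneg (w i)) (hτ.dual_nonneg m i hi)
    omega
  · change monomial m (x q) = _
    rw [(hx q hq).2, formVal, prod_zpow_eq_div]
    simp only [evalAt, map_mul, MvPolynomial.eval_C]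
    ring

/-- The orbit containing a given point of a map in monomial form. -/
theorem HasMonomialForm.exists_mem_torusOrbit {n a : ℕ} {F : Fan n} {u : Fin a → Lat n}
    {w : Fin a → ℕ} (hw : ∀ i, 0 < w i) (hbot : ⊥ ∈ F.cones) (hray : ∀ i, ray (u i) ∈ F.cones)
    {v : Fin a → Fin 2 → ℂ} (hv : PairwiseIndep v) {c : DualLat n → ℂ}
    {φ : P1 → ToricVariety F} (hφ : HasMonomialForm F u w c v φ) (q : P1) :
    ∃ τ : F.cones, φ q ∈ torusOrbit F τ ∧
      (((∀ i, lform (v i) q.rep ≠ 0) ∧ τ.1 = ⊥) ∨ ∃ i, lform (v i) q.rep = 0 ∧ τ.1 = ray (u i)) := by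
  obtain ⟨τ, hτ, -, hcase⟩ := exists_minimal_supports hbot hray hv q.rep_nonzero
  refine ⟨τ, ?_, hcase⟩
  obtain ⟨y, hy, hy'⟩ := hφ q.rep q.rep_nonzero τ hτ
  rw [q.mk_rep] at hy
  refine ⟨y, hy, fun m => ⟨fun hne => ?_, fun h => monomial_ne_zero_of_perp m h y⟩⟩
  rcases hcase with ⟨-, h⟩ | ⟨i, hi, h⟩
  · exact fun v hv => pairing_eq_zero_of_mem_bot m.1 (h.le hv)
  · suffices h0 : m.1 (u i) = 0 from fun v hv => ray_perp.2 h0 v (h.le hv)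
    rw [hy' m] at hne
    have h1 := Finset.prod_ne_zero_iff.1 (right_ne_zero_of_mul hne) i (Finset.mem_univ i)
    rw [hi] at h1
    by_contra h2
    exact h1 (zero_zpow _ (mul_ne_zero (by exact_mod_cast (hw i).ne') h2))

/-- A map in monomial form meets exactly the divisors of the rays of the `u_i`, the latter at the
point `v_i`. -/
theorem HasMonomialForm.mem_toricStratum_iff {n a : ℕ} {F : Fan n} {u : Fin a → Lat n}
    {w : Fin a → ℕ} (hw : ∀ i, 0 < w i) (hbot : ⊥ ∈ F.cones) (hray : ∀ i, ray (u i) ∈ F.cones)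
    {v : Fin a → Fin 2 → ℂ} (hv : PairwiseIndep v) {c : DualLat n → ℂ}
    {φ : P1 → ToricVariety F} (hφ : HasMonomialForm F u w c v φ) (q : P1) {ρ : F.cones}
    (hρ : 0 < coneDim ρ.1) :
    φ q ∈ toricStratum F ρ ↔ ∃ i, lform (v i) q.rep = 0 ∧ ρ.1 = ray (u i) := by
  obtain ⟨τ, hτ, hcase⟩ := hφ.exists_mem_torusOrbit hw hbot hray hv q
  have hρ0 : ρ.1 ≠ ⊥ := fun h => by rw [h, coneDim_bot] at hρ; exact hρ.false
  constructor
  · rintro ⟨τ', hle, hτ'⟩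
    obtain rfl := torusOrbit_disjoint hτ hτ'
    rcases hcase with ⟨-, h⟩ | ⟨i, hi, h⟩
    · rw [h] at hle
      exact absurd (le_bot_iff.1 hle) hρ0
    · rw [h] at hle
      exact ⟨i, hi, (eq_bot_or_eq_of_le_ray hle).resolve_left hρ0⟩
  · rintro ⟨i, hi, h⟩
    rcases hcase with ⟨h', -⟩ | ⟨j, hj, h'⟩
    · exact absurd hi (h' i)
    · obtain rfl := hv.eq_of_lform_eq_zero q.rep_nonzero hi hj
      exact ⟨τ, by rw [h, h'], hτ⟩

theorem HasMonomialForm.isToricallyTransverse {n a : ℕ} {F : Fan n} {u : Fin a → Lat n}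
    {w : Fin a → ℕ} (hw : ∀ i, 0 < w i) (hu : ∀ i, IsPrimitive (u i)) (hbot : ⊥ ∈ F.cones)
    (hray : ∀ i, ray (u i) ∈ F.cones)
    {v : Fin a → Fin 2 → ℂ} (hv : PairwiseIndep v) {c : DualLat n → ℂ}
    {φ : P1 → ToricVariety F} (hφ : HasMonomialForm F u w c v φ) : IsToricallyTransverse F φ := by
  constructor
  · intro d R hR hR0
    -- the factor `X 0` makes sure that the point found is not the origin
    have hl : ∀ i, lpoly (v i) ≠ 0 := by
      intro i h
      obtain ⟨r, hr⟩ := (eventually_lform_real_ne_zero (v := fun _ : Fin 1 => v i)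
        (fun _ => hv.1 i)).exists
      apply hr 0
      rw [← eval_lpoly, h, map_zero]
    have hne : R * formPoly Finset.univ v (fun _ => 1) * MvPolynomial.X 0 ≠ 0 :=
      mul_ne_zero (mul_ne_zero hR0 (Finset.prod_ne_zero_iff.2 fun i _ => pow_ne_zero _ (hl i)))
        (MvPolynomial.X_ne_zero 0)
    obtain ⟨x, hx⟩ : ∃ x, MvPolynomial.eval x
        (R * formPoly Finset.univ v (fun _ => 1) * MvPolynomial.X 0) ≠ 0 := by
      by_contra! h
      exact hne (MvPolynomial.funext fun x => by rw [h x, map_zero])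
    rw [map_mul, map_mul, MvPolynomial.eval_X, eval_formPoly] at hx
    have hx0 : x ≠ 0 := by
      rintro rfl
      exact right_ne_zero_of_mul hx rfl
    obtain ⟨b, hb⟩ := Projectivization.exists_smul_eq_mk_rep ℂ x hx0
    refine ⟨Projectivization.mk ℂ x hx0, ?_, ?_⟩
    · rw [evalAt, ← hb, Units.smul_def, eval_smul_of_isHomogeneous hR]
      exact mul_ne_zero (pow_ne_zero _ b.ne_zero) (left_ne_zero_of_mul (left_ne_zero_of_mul hx))
    · obtain ⟨τ, hτ, hcase⟩ := hφ.exists_mem_torusOrbit hw hbot hray hv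
        (Projectivization.mk ℂ x hx0)
      rcases hcase with ⟨-, h⟩ | ⟨i, hi, -⟩
      · exact ⟨τ, by rw [h, coneDim_bot], hτ⟩
      · exfalso
        rw [← hb, Units.smul_def, lform_smul_right] at hi
        have := Finset.prod_ne_zero_iff.1 (right_ne_zero_of_mul (left_ne_zero_of_mul hx)) i
          (Finset.mem_univ i)
        rw [pow_one] at this
        exact mul_ne_zero b.ne_zero this hi
  · intro σ hσ p hp
    obtain ⟨i, -, h⟩ := (hφ.mem_toricStratum_iff hw hbot hray hv p (ρ := σ) (by omega)).1 hp
    rw [h, coneDim_ray (hu i).ne_zero] at hσ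
    exact lt_irrefl _ hσ

theorem HasMonomialForm.isLine {n a : ℕ} {F : Fan n} {u : Fin a → Lat n} {w : Fin a → ℕ}
    (ha : 0 < a) (ha' : a ≤ 3) (hw : ∀ i, 0 < w i) (hu : ∀ i, IsPrimitive (u i))
    (hinj : Function.Injective u) (hbal : ∑ i, w i • u i = 0) (hbot : ⊥ ∈ F.cones)
    (hray : ∀ i, ray (u i) ∈ F.cones) {v : Fin a → Fin 2 → ℂ} (hv : PairwiseIndep v)
    {c : DualLat n → ℂ}
    {φ : P1 → ToricVariety F} (hφ : HasMonomialForm F u w c v φ) : IsLine F φ where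
  isMorphism := hφ.isMorphism hbal hbot hray hv
  nonconstant := by
    obtain ⟨r, hr⟩ := (eventually_lform_real_ne_zero hv.1).exists
    refine ⟨Projectivization.mk ℂ (v ⟨0, ha⟩) (hv.1 _),
      Projectivization.mk ℂ _ (vec_real_ne_zero r), fun h => ?_⟩
    have hdim : 0 < coneDim (ray (u ⟨0, ha⟩)) := by
      rw [coneDim_ray (hu _).ne_zero]; exact one_pos
    have h1 := (hφ.mem_toricStratum_iff hw hbot hray hv
      (Projectivization.mk ℂ (v ⟨0, ha⟩) (hv.1 _)) (ρ := ⟨ray (u ⟨0, ha⟩), hray ⟨0, ha⟩⟩) hdim).2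
      ⟨⟨0, ha⟩, lform_mk_rep (hv.1 _), rfl⟩
    rw [h] at h1
    obtain ⟨i, hi, -⟩ := (hφ.mem_toricStratum_iff hw hbot hray hv _
      (ρ := ⟨ray (u ⟨0, ha⟩), hray ⟨0, ha⟩⟩) hdim).1 h1
    obtain ⟨b, hb⟩ := Projectivization.exists_smul_eq_mk_rep ℂ _ (vec_real_ne_zero r)
    rw [← hb, Units.smul_def, lform_smul_right] at hi
    exact mul_ne_zero b.ne_zero (hr i) hi
  transverse := hφ.isToricallyTransverse hw hu hbot hray hv
  subsingleton := by
    intro ρ hρ p hp q hq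
    obtain ⟨i, hi, h⟩ := (hφ.mem_toricStratum_iff hw hbot hray hv p (ρ := ρ) (by omega)).1 hp
    obtain ⟨j, hj, h'⟩ := (hφ.mem_toricStratum_iff hw hbot hray hv q (ρ := ρ) (by omega)).1 hq
    obtain rfl := hinj (ray_injective (hu i) (hu j) (h.symm.trans h'))
    rw [lform_rep_eq_zero_iff (hv.1 i)] at hi hj
    rw [hi, hj]
  card_le := by
    have hsub : {ρ : F.cones | coneDim ρ.1 = 1 ∧ (φ ⁻¹' toricStratum F ρ).Nonempty} ⊆
        (fun i : Fin a => (⟨ray (u i), hray i⟩ : F.cones)) '' Set.univ := by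
      rintro ρ ⟨hρ, q, hq⟩
      obtain ⟨i, -, h⟩ := (hφ.mem_toricStratum_iff hw hbot hray hv q (ρ := ρ) (by omega)).1 hq
      exact ⟨i, trivial, Subtype.ext h.symm⟩
    refine (Set.encard_le_encard hsub).trans ((Set.encard_image_le _ _).trans ?_)
    rw [Set.encard_univ]
    simp only [ENat.card_eq_coe_fintype_card, Fintype.card_fin]
    exact_mod_cast ha'

theorem HasMonomialForm.hasContactOrder {n a : ℕ} {F : Fan n} {u : Fin a → Lat n}
    {w : Fin a → ℕ} (hu : ∀ i, IsPrimitive (u i)) (hbal : ∑ i, w i • u i = 0)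
    (hray : ∀ i, ray (u i) ∈ F.cones) {v : Fin a → Fin 2 → ℂ} (hv : PairwiseIndep v)
    {c : DualLat n → ℂ} (hc : ∀ m, c m ≠ 0)
    {φ : P1 → ToricVariety F} (hφ : HasMonomialForm F u w c v φ) (i : Fin a) :
    HasContactOrder F φ ⟨ray (u i), hray i⟩ (u i) (Projectivization.mk ℂ (v i) (hv.1 i)) (w i) := by
  set p := Projectivization.mk ℂ (v i) (hv.1 i) with hp
  obtain ⟨b, hb⟩ := Projectivization.exists_smul_eq_mk_rep ℂ (v i) (hv.1 i)
  rw [← hp, Units.smul_def] at hb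
  have hpi : lform (v i) p.rep = 0 := lform_mk_rep (hv.1 i)
  have hs := supports_ray (u := u) hv p.rep_nonzero hpi
  obtain ⟨x, hx⟩ := hφ.exists_chart ⟨ray (u i), hray i⟩
  obtain ⟨m, hm⟩ := (hu i).exists_dual_eq_one
  -- `z^m` is `ℓ_i ^ w_i` times a product of powers of the other forms, which do not vanish at `p`
  have hne : ∀ j ∈ Finset.univ.erase i, lform (v j) p.rep ≠ 0 := fun j hj h =>
    (Finset.mem_erase.1 hj).1 (hv.eq_of_lform_eq_zero p.rep_nonzero h hpi)
  refine ⟨x, (nearPoint_supports hs).mono fun q hq => (hx q hq).1,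
    ⟨m, mem_dualMonoid_ray.2 (by omega)⟩, hm, ?_⟩
  have hdeg := sum_toNat_eq (Finset.univ.erase i) fun j => (w j : ℤ) * m (u j)
  have hsum := Finset.add_sum_erase Finset.univ (fun j => (w j : ℤ) * m (u j)) (Finset.mem_univ i)
  simp only [sum_weights_eq_zero hbal, hm, mul_one] at hsum
  refine ⟨_, MvPolynomial.C (c m * (b : ℂ)⁻¹ ^ w i) *
      formPoly (Finset.univ.erase i) v fun j => ((w j : ℤ) * m (u j)).toNat,
    formPoly (Finset.univ.erase i) v fun j => (-((w j : ℤ) * m (u j))).toNat,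
    (MvPolynomial.isHomogeneous_C (Fin 2) _).mul (formPoly_isHomogeneous _ _ _), ?_, ?_, ?_,
    (nearPoint_supports hs).mono fun q hq => ?_⟩
  · convert formPoly_isHomogeneous (Finset.univ.erase i) v
      (fun j => (-((w j : ℤ) * m (u j))).toNat) using 1
    omega
  · rw [evalAt, map_mul, MvPolynomial.eval_C]
    exact mul_ne_zero (mul_ne_zero (hc m) (pow_ne_zero _ (inv_ne_zero b.ne_zero)))
      (eval_formPoly_ne_zero fun j hj h => absurd h (hne j hj))
  · exact eval_formPoly_ne_zero fun j hj h => absurd h (hne j hj)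
  · change monomial _ (x q) = _
    rw [(hx q hq).2]
    have h1 : evalAt (MvPolynomial.C (p.rep 1) * MvPolynomial.X 0
        - MvPolynomial.C (p.rep 0) * MvPolynomial.X 1) q = b * lform (v i) q.rep := by
      rw [← lform_smul_left, hb]
      exact eval_lpoly p.rep q.rep
    have hb0 := b.ne_zero
    change c m * formVal u w v m q.rep = _
    rw [h1, formVal, ← Finset.mul_prod_erase _ _ (Finset.mem_univ i), prod_zpow_eq_div, hm, mul_one,
      zpow_natCast]
    simp only [evalAt, map_mul, MvPolynomial.eval_C]
    rw [mul_pow, inv_pow]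
    field_simp

theorem HasMonomialForm.hasType {n a : ℕ} {F : Fan n} {u : Fin a → Lat n} {w : Fin a → ℕ}
    (hw : ∀ i, 0 < w i) (hu : ∀ i, IsPrimitive (u i))
    (hinj : Function.Injective u) (hbal : ∑ i, w i • u i = 0) (hbot : ⊥ ∈ F.cones)
    (hray : ∀ i, ray (u i) ∈ F.cones) {v : Fin a → Fin 2 → ℂ} (hv : PairwiseIndep v)
    {c : DualLat n → ℂ} (hc : ∀ m, c m ≠ 0)
    {φ : P1 → ToricVariety F} (hφ : HasMonomialForm F u w c v φ) : HasType F φ u w := by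
  constructor
  · intro ρ hρ
    constructor
    · rintro ⟨q, hq⟩
      obtain ⟨i, -, h⟩ := (hφ.mem_toricStratum_iff hw hbot hray hv q (ρ := ρ) (by omega)).1 hq
      exact ⟨i, h⟩
    · rintro ⟨i, h⟩
      exact ⟨Projectivization.mk ℂ (v i) (hv.1 i),
        (hφ.mem_toricStratum_iff hw hbot hray hv (Projectivization.mk ℂ (v i) (hv.1 i))
          (by omega)).2 ⟨i, lform_mk_rep (hv.1 i), h⟩⟩
  · intro i
    refine ⟨⟨ray (u i), hray i⟩, rfl, {Projectivization.mk ℂ (v i) (hv.1 i)}, fun _ => w i, ?_, ?_,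
      by simp⟩
    · ext q
      have hdim : 0 < coneDim (ray (u i)) := by
        rw [coneDim_ray (hu _).ne_zero]; exact one_pos
      rw [Finset.coe_singleton, Set.mem_singleton_iff, Set.mem_preimage,
        hφ.mem_toricStratum_iff hw hbot hray hv q (ρ := ⟨ray (u i), hray i⟩) hdim]
      constructor
      · intro h
        exact ⟨i, (lform_rep_eq_zero_iff (hv.1 i) _).2 h, rfl⟩
      · rintro ⟨j, hj, h⟩
        obtain rfl := hinj (ray_injective (hu i) (hu j) h)
        exact (lform_rep_eq_zero_iff (hv.1 _) _).1 hj
    · intro p hp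
      rw [Finset.mem_singleton.1 hp]
      exact hφ.hasContactOrder hu hbal hray hv hc i

theorem lform_star {v : Fin 2 → ℂ} (hv : star v = v) (x : Fin 2 → ℂ) :
    lform v (star x) = star (lform v x) := by
  have h0 : star (v 0) = v 0 := congrFun hv 0
  have h1 : star (v 1) = v 1 := congrFun hv 1
  simp only [lform, star_sub, star_mul', Pi.star_apply, h0, h1]

theorem conjP1_mk {x : Fin 2 → ℂ} (hx : x ≠ 0) : conjP1 (Projectivization.mk ℂ x hx) =
    Projectivization.mk ℂ (star x) (star_ne_zero.2 hx) := rfl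

theorem HasMonomialForm.isRealMap {n a : ℕ} {F : Fan n} {u : Fin a → Lat n} {w : Fin a → ℕ}
    (hbot : ⊥ ∈ F.cones) (hray : ∀ i, ray (u i) ∈ F.cones) {v : Fin a → Fin 2 → ℂ}
    (hv : PairwiseIndep v) (hvreal : ∀ i, star (v i) = v i) {c : DualLat n → ℂ}
    (hcreal : ∀ m, star (c m) = c m) {φ : P1 → ToricVariety F}
    (hφ : HasMonomialForm F u w c v φ) : IsRealMap F φ := by
  intro p
  induction p using Projectivization.ind with
  | h x hx =>
  obtain ⟨τ, hτ, -⟩ := exists_minimal_supports (u := u) hbot hray hv hx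
  obtain ⟨y, hy, hy'⟩ := hφ x hx τ hτ
  obtain ⟨z, hz, hz'⟩ := hφ (star x) (star_ne_zero.2 hx) τ fun i hi => hτ i (by
    rwa [lform_star (hvreal i), star_eq_zero] at hi)
  rw [conjP1_mk hx, hz, hy]
  change _ = ofChart F τ ((starRingEnd ℂ : ℂ →* ℂ).comp y)
  congr 1
  refine chart_ext fun m => ?_
  change _ = star (monomial m y)
  rw [hz' m, hy' m, star_mul', hcreal, formVal, formVal, star_prod]
  congr 1
  refine Finset.prod_congr rfl fun i _ => ?_
  rw [lform_star (hvreal i), star_zpow₀]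

/-! ### Units on the affine line -/

theorem eventually_eval_ne_zero {A : Polynomial ℂ} (hA : A ≠ 0) :
    ∀ᶠ z in cofinite, A.eval z ≠ 0 := by
  rw [eventually_cofinite]
  simpa using Polynomial.finite_setOfPred_isRoot hA

theorem poly_eq_of_eventually {A B : Polynomial ℂ}
    (h : ∀ᶠ z in cofinite, A.eval z = B.eval z) : A = B := by
  by_contra hne
  obtain ⟨z, hz, hz'⟩ := (h.and (eventually_eval_ne_zero (sub_ne_zero.2 hne))).exists
  rw [Polynomial.eval_sub, hz, sub_self] at hz'
  exact hz' rfl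

/-- The function `g` agrees, up to finitely many points, with a rational function that has neither
a zero nor a pole at `z`. -/
def UnitAt (g : ℂ → ℂ) (z : ℂ) : Prop :=
  ∃ A B : Polynomial ℂ, A.eval z ≠ 0 ∧ B.eval z ≠ 0 ∧
    ∀ᶠ s in cofinite, g s = A.eval s / B.eval s

theorem UnitAt.congr {f g : ℂ → ℂ} {z : ℂ} (hf : UnitAt f z) (h : ∀ᶠ s in cofinite, g s = f s) :
    UnitAt g z := by
  obtain ⟨A, B, hA, hB, hAB⟩ := hf
  refine ⟨A, B, hA, hB, ?_⟩
  filter_upwards [h, hAB] with s h1 h2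
  rw [h1, h2]

theorem UnitAt.of_poly {A : Polynomial ℂ} {z : ℂ} (hA : A.eval z ≠ 0) :
    UnitAt (fun s => A.eval s) z :=
  ⟨A, 1, hA, by simp, Eventually.of_forall fun s => by simp⟩

theorem UnitAt.mul {f g : ℂ → ℂ} {z : ℂ} (hf : UnitAt f z) (hg : UnitAt g z) :
    UnitAt (fun s => f s * g s) z := by
  obtain ⟨A, B, hA, hB, hAB⟩ := hf
  obtain ⟨A', B', hA', hB', hAB'⟩ := hg
  refine ⟨A * A', B * B', by simp [hA, hA'], by simp [hB, hB'], ?_⟩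
  filter_upwards [hAB, hAB'] with s h1 h2
  rw [h1, h2, Polynomial.eval_mul, Polynomial.eval_mul, div_mul_div_comm]

theorem UnitAt.inv {f : ℂ → ℂ} {z : ℂ} (hf : UnitAt f z) : UnitAt (fun s => (f s)⁻¹) z := by
  obtain ⟨A, B, hA, hB, hAB⟩ := hf
  refine ⟨B, A, hB, hA, ?_⟩
  filter_upwards [hAB] with s h1
  rw [h1, inv_div]

theorem UnitAt.one (z : ℂ) : UnitAt (fun _ => 1) z :=
  ⟨1, 1, by simp, by simp, Eventually.of_forall fun s => by simp⟩

theorem UnitAt.pow {f : ℂ → ℂ} {z : ℂ} (hf : UnitAt f z) (k : ℕ) : UnitAt (fun s => f s ^ k) z := by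
  induction k with
  | zero => simpa using UnitAt.one z
  | succ k ih => simpa only [pow_succ] using ih.mul hf

theorem UnitAt.zpow {f : ℂ → ℂ} {z : ℂ} (hf : UnitAt f z) (k : ℤ) :
    UnitAt (fun s => f s ^ k) z := by
  cases k with
  | ofNat k => simpa using hf.pow k
  | negSucc k => simpa only [zpow_negSucc] using (hf.pow (k + 1)).inv

theorem UnitAt.prod {ι : Type*} {f : ι → ℂ → ℂ} {z : ℂ} (s : Finset ι)
    (hf : ∀ i ∈ s, UnitAt (f i) z) : UnitAt (fun t => ∏ i ∈ s, f i t) z := by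
  classical
  induction s using Finset.induction_on with
  | empty => simpa using UnitAt.one z
  | insert i s hi ih =>
    simp only [Finset.prod_insert hi]
    exact (hf i (Finset.mem_insert_self i s)).mul
      (ih fun j hj => hf j (Finset.mem_insert_of_mem hj))

/-- A rational function without zeros and poles on the affine line is constant: its numerator and
denominator have the same roots. -/
theorem exists_const_of_unitAt {g : ℂ → ℂ} (hg : ∀ z, UnitAt g z) :
    ∃ c : ℂ, c ≠ 0 ∧ ∀ᶠ z in cofinite, g z = c := by
  obtain ⟨A, B, hA0, hB0, hAB⟩ := hg 0
  have hA : A ≠ 0 := by rintro rfl; simp at hA0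
  have hB : B ≠ 0 := by rintro rfl; simp at hB0
  have hroots : A.roots = B.roots := by
    ext z
    obtain ⟨A', B', hA', hB', hAB'⟩ := hg z
    have hA0' : A' ≠ 0 := by rintro rfl; simp at hA'
    have hB0' : B' ≠ 0 := by rintro rfl; simp at hB'
    have heq : A * B' = A' * B := by
      apply poly_eq_of_eventually
      filter_upwards [hAB, hAB', eventually_eval_ne_zero hB, eventually_eval_ne_zero hB0'] with
        s h1 h2 h3 h4
      rw [h1, div_eq_div_iff h3 h4] at h2
      rw [Polynomial.eval_mul, Polynomial.eval_mul, h2]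
    have h1 := congrArg (Polynomial.rootMultiplicity z) heq
    rw [Polynomial.rootMultiplicity_mul (mul_ne_zero hA hB0'),
      Polynomial.rootMultiplicity_mul (mul_ne_zero hA0' hB),
      Polynomial.rootMultiplicity_eq_zero hA', Polynomial.rootMultiplicity_eq_zero hB'] at h1
    rw [Polynomial.count_roots, Polynomial.count_roots]
    omega
  have hfac : ∀ z (C : Polynomial ℂ), C.eval z = C.leadingCoeff *
      ((C.roots.map fun r => Polynomial.X - Polynomial.C r).prod).eval z := by
    intro z C
    conv_lhs => rw [(IsAlgClosed.splits C).eq_prod_roots]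
    simp
  refine ⟨A.leadingCoeff / B.leadingCoeff, div_ne_zero (Polynomial.leadingCoeff_ne_zero.2 hA)
    (Polynomial.leadingCoeff_ne_zero.2 hB), ?_⟩
  filter_upwards [hAB, eventually_eval_ne_zero hB] with z h1 h2
  rw [h1]
  rw [hfac] at h2
  rw [hfac z A, hfac z B, hroots, mul_div_mul_right _ _ (right_ne_zero_of_mul h2)]

/-! ### Affine parametrizations of the projective line -/

theorem add_smul_ne_zero {b d : Fin 2 → ℂ} (h : lform b d ≠ 0) (z : ℂ) : b + z • d ≠ 0 := by
  intro h0
  apply h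
  have h1 : lform (b + z • d) d = lform b d := by
    simp [lform]; ring
  rw [← h1, h0]
  simp [lform]

/-- The affine parametrization `z ↦ [b + z d]` of the complement of `[d]`. -/
noncomputable def affineCurve {b d : Fin 2 → ℂ} (h : lform b d ≠ 0) (z : ℂ) : P1 :=
  Projectivization.mk ℂ (b + z • d) (add_smul_ne_zero h z)

theorem affineCurve_injective {b d : Fin 2 → ℂ} (h : lform b d ≠ 0) :
    Function.Injective (affineCurve h) := by
  intro z z' hz
  obtain ⟨c, hc⟩ := (Projectivization.mk_eq_mk_iff ℂ _ _ _ _).1 hz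
  rw [Units.smul_def] at hc
  have h1 : lform (b + z' • d) (b + z • d) = 0 := by
    rw [← hc, lform_smul_right, lform_self, mul_zero]
  have h2 : (z - z') * lform b d = 0 := by
    rw [← h1]
    simp [lform]; ring
  exact sub_eq_zero.1 ((mul_eq_zero.1 h2).resolve_right h)

theorem exists_affineCurve_eq {b d : Fin 2 → ℂ} (h : lform b d ≠ 0) {q : P1}
    (hq : lform d q.rep ≠ 0) : ∃ z, affineCurve h z = q := by
  refine ⟨lform b q.rep / -lform d q.rep, ?_⟩
  conv_rhs => rw [← q.mk_rep]
  rw [affineCurve, Projectivization.mk_eq_mk_iff]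
  refine ⟨Units.mk0 (lform b d / -lform d q.rep) (div_ne_zero h (neg_ne_zero.2 hq)), ?_⟩
  rw [Units.smul_mk0, div_eq_inv_mul, mul_smul, lform_smul_eq b d q.rep, div_eq_inv_mul, mul_smul,
    smul_add, lform_swap q.rep d, smul_smul, inv_mul_cancel₀ (neg_ne_zero.2 hq), one_smul]

theorem eventually_of_affineCurve {b d : Fin 2 → ℂ} (h : lform b d ≠ 0) {T : P1 → Prop}
    (hT : ∀ᶠ z in cofinite, T (affineCurve h z)) : ∀ᶠ q in cofinite, T q := by
  have hd : d ≠ 0 := by rintro rfl; simp [lform] at h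
  rw [eventually_cofinite] at hT ⊢
  refine ((hT.image (affineCurve h)).union (Set.finite_singleton (Projectivization.mk ℂ d hd))).subset
    fun q hq => ?_
  by_cases h0 : lform d q.rep = 0
  · exact Or.inr ((lform_rep_eq_zero_iff hd q).1 h0)
  · obtain ⟨z, rfl⟩ := exists_affineCurve_eq h h0
    exact Or.inl ⟨z, hq, rfl⟩

theorem tendsto_affineCurve {b d : Fin 2 → ℂ} (h : lform b d ≠ 0) :
    Tendsto (affineCurve h) cofinite cofinite := (affineCurve_injective h).tendsto_cofinite

theorem exists_lform_ne_zero {b : Fin 2 → ℂ} (hb : b ≠ 0) : ∃ d, lform b d ≠ 0 := by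
  by_contra! h
  apply hb
  ext i
  fin_cases i
  · simpa [lform] using h ![0, 1]
  · simpa [lform] using h ![1, 0]

/-- The restriction of a polynomial to the affine line `z ↦ b + z d`. -/
noncomputable def pull (b d : Fin 2 → ℂ) (P : MvPolynomial (Fin 2) ℂ) : Polynomial ℂ :=
  MvPolynomial.aeval (fun i => Polynomial.C (b i) + Polynomial.X * Polynomial.C (d i)) P

theorem eval_pull (b d : Fin 2 → ℂ) (P : MvPolynomial (Fin 2) ℂ) (z : ℂ) :
    (pull b d P).eval z = MvPolynomial.eval (b + z • d) P := by
  induction P using MvPolynomial.induction_on with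
  | C a => simp [pull]
  | add p q hp hq => simp only [pull, map_add, Polynomial.eval_add] at hp hq ⊢; rw [hp, hq]
  | mul_X p i hp =>
    simp only [pull, map_mul, Polynomial.eval_mul, MvPolynomial.aeval_X, MvPolynomial.eval_X]
      at hp ⊢
    rw [hp]
    congr 1
    simp only [Polynomial.eval_add, Polynomial.eval_mul, Polynomial.eval_C, Polynomial.eval_X,
      Pi.add_apply, Pi.smul_apply, smul_eq_mul]

theorem exists_rep_affineCurve {b d : Fin 2 → ℂ} (h : lform b d ≠ 0) (z : ℂ) :
    ∃ c : ℂ, c ≠ 0 ∧ (affineCurve h z).rep = c • (b + z • d) := by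
  obtain ⟨c, hc⟩ := Projectivization.exists_smul_eq_mk_rep ℂ _ (add_smul_ne_zero h z)
  exact ⟨c, c.ne_zero, hc.symm⟩

theorem evalAt_affineCurve_ne_zero_iff {b d : Fin 2 → ℂ} (h : lform b d ≠ 0) {k : ℕ}
    {P : MvPolynomial (Fin 2) ℂ} (hP : P.IsHomogeneous k) (z : ℂ) :
    evalAt P (affineCurve h z) ≠ 0 ↔ (pull b d P).eval z ≠ 0 := by
  obtain ⟨c, hc, hc'⟩ := exists_rep_affineCurve h z
  rw [evalAt, hc', eval_smul_of_isHomogeneous hP, eval_pull]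
  simp [hc]

theorem evalAt_div_affineCurve {b d : Fin 2 → ℂ} (h : lform b d ≠ 0) {k : ℕ}
    {P Q : MvPolynomial (Fin 2) ℂ} (hP : P.IsHomogeneous k) (hQ : Q.IsHomogeneous k) (z : ℂ) :
    evalAt P (affineCurve h z) / evalAt Q (affineCurve h z)
      = (pull b d P).eval z / (pull b d Q).eval z := by
  obtain ⟨c, hc, hc'⟩ := exists_rep_affineCurve h z
  rw [evalAt, evalAt, hc', eval_smul_of_isHomogeneous hP, eval_smul_of_isHomogeneous hQ, eval_pull,
    eval_pull, mul_div_mul_left _ _ (pow_ne_zero _ hc)]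

theorem eventually_evalAt_ne_zero {k : ℕ} {R : MvPolynomial (Fin 2) ℂ} (hR : R.IsHomogeneous k)
    {p : P1} (hp : evalAt R p ≠ 0) : ∀ᶠ q in cofinite, evalAt R q ≠ 0 := by
  obtain ⟨d, hd⟩ := exists_lform_ne_zero p.rep_nonzero
  apply eventually_of_affineCurve hd
  have hne : pull p.rep d R ≠ 0 := by
    intro h
    have := eval_pull p.rep d R 0
    rw [h, zero_smul, add_zero, Polynomial.eval_zero] at this
    exact hp this.symm
  filter_upwards [eventually_eval_ne_zero hne] with z hz
  exact (evalAt_affineCurve_ne_zero_iff hd hR z).2 hz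

theorem NearPoint.eventually {p : P1} {T : P1 → Prop} (h : NearPoint p T) :
    ∀ᶠ q in cofinite, T q := by
  obtain ⟨d, R, hR, hp, hq⟩ := h
  exact (eventually_evalAt_ne_zero hR hp).mono hq

theorem NearPoint.self {p : P1} {T : P1 → Prop} (h : NearPoint p T) : T p := by
  obtain ⟨d, R, hR, hp, hq⟩ := h
  exact hq p hp

theorem unitAt_of_evalAt_div {b d : Fin 2 → ℂ} (h : lform b d ≠ 0) {k : ℕ}
    {P Q : MvPolynomial (Fin 2) ℂ} (hP : P.IsHomogeneous k) (hQ : Q.IsHomogeneous k) {z : ℂ}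
    (hPz : evalAt P (affineCurve h z) ≠ 0) (hQz : evalAt Q (affineCurve h z) ≠ 0) {f : P1 → ℂ}
    (hf : ∀ᶠ q in cofinite, f q = evalAt P q / evalAt Q q) :
    UnitAt (fun s => f (affineCurve h s)) z := by
  refine ⟨pull b d P, pull b d Q, (evalAt_affineCurve_ne_zero_iff h hP z).1 hPz,
    (evalAt_affineCurve_ne_zero_iff h hQ z).1 hQz, ?_⟩
  filter_upwards [(tendsto_affineCurve h).eventually hf] with s hs
  rw [hs, evalAt_div_affineCurve h hP hQ]

/-! ### Lines are given by products of powers of linear forms -/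

/-- A line of type `(u, w)` maps the point `v_i` to the divisor of `u_i`, and all other points to
the big torus orbit. -/
theorem IsLine.exists_mem_torusOrbit {n a : ℕ} {F : Fan n} {u : Fin a → Lat n} {w : Fin a → ℕ}
    (hu : ∀ i, IsPrimitive (u i)) (hray : ∀ i, ray (u i) ∈ F.cones)
    {φ : P1 → ToricVariety F} (hφ : IsLine F φ) (hφt : HasType F φ u w)
    {v : Fin a → Fin 2 → ℂ} (hv : ∀ i, v i ≠ 0)
    (hv' : ∀ i, φ (Projectivization.mk ℂ (v i) (hv i)) ∈ toricStratum F ⟨ray (u i), hray i⟩)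
    (q : P1) :
    ∃ τ : F.cones, φ q ∈ torusOrbit F τ ∧
      (((∀ i, lform (v i) q.rep ≠ 0) ∧ τ.1 = ⊥) ∨
        ∃ i, lform (v i) q.rep = 0 ∧ τ.1 = ray (u i)) := by
  obtain ⟨τ, hτ⟩ := ToricLines.exists_mem_torusOrbit F (φ q)
  have hle : coneDim τ.1 ≤ 1 := by
    by_contra! h
    exact hφ.transverse.2 τ h q ⟨τ, le_rfl, hτ⟩
  refine ⟨τ, hτ, ?_⟩
  rcases Nat.le_one_iff_eq_zero_or_eq_one.1 hle with h | h
  · left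
    have hbot := eq_bot_of_coneDim_eq_zero h
    refine ⟨fun i hi => ?_, hbot⟩
    rw [lform_rep_eq_zero_iff (hv i)] at hi
    obtain ⟨τ', hle', hτ'⟩ := hv' i
    rw [← hi] at hτ'
    obtain rfl := torusOrbit_disjoint hτ hτ'
    have h1 := hle' (latToReal_mem_ray (u i))
    rw [hbot, Submodule.mem_bot] at h1
    exact latToReal_ne_zero (hu i).ne_zero h1
  · right
    have hq : q ∈ φ ⁻¹' toricStratum F τ := ⟨τ, le_rfl, hτ⟩
    obtain ⟨i, hi⟩ := (hφt.1 τ h).1 ⟨q, hq⟩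
    refine ⟨i, ?_, hi⟩
    have hτi : τ = ⟨ray (u i), hray i⟩ := Subtype.ext hi
    have hp : Projectivization.mk ℂ (v i) (hv i) ∈ φ ⁻¹' toricStratum F τ := by
      rw [hτi]; exact hv' i
    rw [lform_rep_eq_zero_iff (hv i)]
    exact hφ.subsingleton τ h hq hp

theorem monomial_zsmul_bot {n : ℕ} (k : ℤ) (m : DualLat n) (x : AffineChart (⊥ : Cone n)) :
    monomial ⟨k • m, mem_dualMonoid_bot _⟩ x = monomial ⟨m, mem_dualMonoid_bot _⟩ x ^ k := by
  cases k with
  | ofNat k =>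
    rw [Int.ofNat_eq_natCast, zpow_natCast, ← monomial_nsmul]
    exact congrArg (monomial · x) (Subtype.ext (natCast_zsmul m k))
  | negSucc k =>
    rw [zpow_negSucc]
    apply eq_inv_of_mul_eq_one_left
    rw [← monomial_nsmul, ← monomial_add, ← monomial_zero x]
    congr 1
    apply Subtype.ext
    change Int.negSucc k • m + (k + 1) • m = 0
    rw [negSucc_zsmul, neg_add_cancel]

/-- The coordinates of a morphism `φ` in the smallest affine chart containing `φ(p)` are regular at
`p`. They are compared with the torus coordinates `χ` of `φ`, defined at all but finitely many
points. -/
theorem IsMorphism.regular_minimal_chart {n : ℕ} {F : Fan n} {φ : P1 → ToricVariety F}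
    (hφ : IsMorphism F φ) (hbot : ⊥ ∈ F.cones) {χ : P1 → AffineChart (⊥ : Cone n)}
    (hχ : ∀ᶠ q in cofinite, φ q = ofChart F ⟨⊥, hbot⟩ (χ q)) {p : P1} {τ : F.cones}
    {y : AffineChart τ.1} (hy : φ p = ofChart F τ y) (hy' : IsOrbitPoint y) (m : dualMonoid τ.1) :
    ∃ (d : ℕ) (P Q : MvPolynomial (Fin 2) ℂ), P.IsHomogeneous d ∧ Q.IsHomogeneous d ∧
      evalAt Q p ≠ 0 ∧ monomial m y = evalAt P p / evalAt Q p ∧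
      ∀ᶠ q in cofinite, monomial ⟨m.1, mem_dualMonoid_bot _⟩ (χ q) = evalAt P q / evalAt Q q := by
  obtain ⟨σ, x, hx, hreg⟩ := hφ p
  have hxp : ofChart F σ (x p) = ofChart F τ y := hx.self.symm.trans hy
  obtain ⟨hle, hxy⟩ := hy'.le_and_eq hxp
  obtain ⟨m₀, hm₀, hface⟩ := F.isFace_of_le σ.2 τ.2 hle
  obtain ⟨k, hk⟩ := exists_add_nsmul_mem (F.rational σ.1 σ.2) hm₀ hface m.2
  -- both `z^(m₀)` and `z^(m + k m₀)` are coordinates of `U_σ`, and `z^(m₀)(φ(p)) ≠ 0`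
  obtain ⟨d₁, P₁, Q₁, hP₁, hQ₁, hQp₁, h₁⟩ := hreg ⟨_, hk⟩
  obtain ⟨d₂, P₂, Q₂, hP₂, hQ₂, hQp₂, h₂⟩ := hreg ⟨m₀, hm₀⟩
  beta_reduce at h₁ h₂
  have hm₀p : monomial ⟨m₀, hm₀⟩ (x p) ≠ 0 := by
    rw [hxy]
    exact monomial_ne_zero hm₀ hface y
  have hPp₂ : evalAt P₂ p ≠ 0 := by
    intro h
    rw [h₂.self, h, zero_div] at hm₀p
    exact hm₀p rfl
  have key : ∀ q, evalAt P₂ q ≠ 0 → evalAt Q₂ q ≠ 0 → ∀ c c₁ c₂ : ℂ, c₁ = c * c₂ ^ k →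
      c₁ = evalAt P₁ q / evalAt Q₁ q → c₂ = evalAt P₂ q / evalAt Q₂ q →
      c = evalAt (P₁ * Q₂ ^ k) q / evalAt (Q₁ * P₂ ^ k) q := by
    intro q hP hQ c c₁ c₂ h e₁ e₂
    have hc₂ : c₂ ^ k ≠ 0 := pow_ne_zero _ (by rw [e₂]; exact div_ne_zero hP hQ)
    rw [← div_eq_iff hc₂] at h
    rw [← h, e₁, e₂]
    simp only [evalAt, map_mul, map_pow]
    rw [div_pow, div_div_div_eq]
  refine ⟨d₁ + d₂ * k, P₁ * Q₂ ^ k, Q₁ * P₂ ^ k, hP₁.mul (hQ₂.pow k), hQ₁.mul (hP₂.pow k), ?_, ?_, ?_⟩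
  · rw [evalAt, map_mul, map_pow]
    exact mul_ne_zero hQp₁ (pow_ne_zero _ hPp₂)
  · refine key p hPp₂ hQp₂ _ _ _ ?_ h₁.self h₂.self
    rw [hxy, monomial_chartMap, monomial_chartMap, ← monomial_nsmul, ← monomial_add]
    rfl
  · filter_upwards [hχ, hx.eventually, h₁.eventually, h₂.eventually,
      eventually_evalAt_ne_zero hP₂ hPp₂, eventually_evalAt_ne_zero hQ₂ hQp₂] with q e e' e₁ e₂ e₃ e₄
    refine key q e₃ e₄ _ _ _ ?_ e₁ e₂
    obtain ⟨hle', hxq⟩ := (isOrbitPoint_bot (χ q)).le_and_eq (τ := ⟨⊥, hbot⟩) (e'.symm.trans e)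
    rw [hxq, monomial_chartMap, monomial_chartMap, ← monomial_nsmul, ← monomial_add]
    rfl

theorem eventually_lform_rep_ne_zero {v : Fin 2 → ℂ} (hv : v ≠ 0) :
    ∀ᶠ q : P1 in cofinite, lform v q.rep ≠ 0 := by
  refine (Set.finite_singleton (Projectivization.mk ℂ v hv)).subset fun q hq => ?_
  exact (lform_rep_eq_zero_iff hv q).1 (not_not.1 hq)

theorem eventually_lform_affine_ne_zero {b d v : Fin 2 → ℂ} (hbd : lform b d ≠ 0) (hv : v ≠ 0) :
    ∀ᶠ s : ℂ in cofinite, lform v (b + s • d) ≠ 0 := by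
  filter_upwards [(tendsto_affineCurve hbd).eventually (eventually_lform_rep_ne_zero hv)] with s hs
  obtain ⟨c, hc, hc'⟩ := exists_rep_affineCurve hbd s
  rw [hc', lform_smul_right] at hs
  exact right_ne_zero_of_mul hs

/-- Dividing by the power of the linear form prescribed by the vanishing order leaves a unit. -/
theorem HasVanishingOrder.unitAt {g : P1 → ℂ} {k : ℕ} {b d v : Fin 2 → ℂ} (hbd : lform b d ≠ 0)
    {z : ℂ} (hv : v ≠ 0) (hp : affineCurve hbd z = Projectivization.mk ℂ v hv)
    (hg : HasVanishingOrder g (affineCurve hbd z) k) :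
    UnitAt (fun s => g (affineCurve hbd s) * (lform v (b + s • d) ^ k)⁻¹) z := by
  obtain ⟨e, R, Q, hR, hQ, hRp, hQp, hev⟩ := hg
  obtain ⟨c, hc, hc'⟩ : ∃ c : ℂ, c ≠ 0 ∧ (affineCurve hbd z).rep = c • v := by
    rw [hp]
    obtain ⟨c, hc⟩ := Projectivization.exists_smul_eq_mk_rep ℂ _ hv
    exact ⟨c, c.ne_zero, hc.symm⟩
  have h1 : UnitAt (fun s => (Polynomial.C (c ^ k)).eval s *
      ((pull b d R).eval s * ((pull b d Q).eval s)⁻¹)) z := by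
    refine UnitAt.mul (UnitAt.of_poly ?_) (UnitAt.mul (UnitAt.of_poly ?_) (UnitAt.of_poly ?_).inv)
    · rw [Polynomial.eval_C]
      exact pow_ne_zero _ hc
    · exact (evalAt_affineCurve_ne_zero_iff hbd hR z).1 hRp
    · exact (evalAt_affineCurve_ne_zero_iff hbd hQ z).1 hQp
  refine h1.congr ?_
  filter_upwards [eventually_lform_affine_ne_zero hbd hv,
    (tendsto_affineCurve hbd).eventually hev.eventually] with s e₁ e₂
  have e₃ : g (affineCurve hbd s) =
      evalAt (lpoly (affineCurve hbd z).rep ^ k * R) (affineCurve hbd s) /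
        evalAt Q (affineCurve hbd s) := by
    rw [e₂]
    simp only [evalAt, map_mul, map_pow]
    rfl
  have hdeg : (lpoly (affineCurve hbd z).rep ^ k * R).IsHomogeneous (k + e) := by
    simpa using ((lpoly_isHomogeneous (affineCurve hbd z).rep).pow k).mul hR
  rw [e₃, evalAt_div_affineCurve hbd hdeg hQ, eval_pull, map_mul, map_pow, eval_lpoly, hc',
    lform_smul_left, ← eval_pull, mul_pow, Polynomial.eval_C]
  field_simp

/-- The torus coordinates of a line, divided by the expected product of linear forms, have neither
zeros nor poles. -/
theorem IsLine.unitAt_affineCurve {n a : ℕ} {F : Fan n} {u : Fin a → Lat n} {w : Fin a → ℕ}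
    (hu : ∀ i, IsPrimitive (u i))
    (hray : ∀ i, ray (u i) ∈ F.cones) (hbot : ⊥ ∈ F.cones)
    {φ : P1 → ToricVariety F} (hφ : IsLine F φ) (hφt : HasType F φ u w)
    {v : Fin a → Fin 2 → ℂ} (hv : PairwiseIndep v)
    (hv' : ∀ i, φ (Projectivization.mk ℂ (v i) (hv.1 i)) ∈ toricStratum F ⟨ray (u i), hray i⟩)
    {χ : P1 → AffineChart (⊥ : Cone n)}
    (hχ : ∀ᶠ q in cofinite, φ q = ofChart F ⟨⊥, hbot⟩ (χ q))
    {b d : Fin 2 → ℂ} (hbd : lform b d ≠ 0) (m : DualLat n) (z : ℂ) :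
    UnitAt (fun s => monomial ⟨m, mem_dualMonoid_bot m⟩ (χ (affineCurve hbd s)) *
      ∏ i, (lform (v i) (b + s • d) ^ ((w i : ℤ) * m (u i)))⁻¹) z := by
  have hlf : ∀ i, lform (v i) (affineCurve hbd z).rep ≠ 0 →
      UnitAt (fun s => lform (v i) (b + s • d)) z := by
    intro i hi
    have h1 := (evalAt_affineCurve_ne_zero_iff hbd (lpoly_isHomogeneous (v i)) z).1
      (by rw [evalAt, eval_lpoly]; exact hi)
    have h2 := UnitAt.of_poly h1
    simpa only [eval_pull, eval_lpoly] using h2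
  obtain ⟨τ, ⟨y, hy, hy'⟩, hcase⟩ := hφ.exists_mem_torusOrbit hu hray hφt hv.1 hv' (affineCurve hbd z)
  have hperp : ∀ l : dualMonoid τ.1, (∀ v ∈ τ.1, pairing l.1 v = 0) →
      UnitAt (fun s => monomial ⟨l.1, mem_dualMonoid_bot l.1⟩ (χ (affineCurve hbd s))) z := by
    intro l hl
    obtain ⟨k, P, Q, hP, hQ, hQp, hval, hev⟩ :=
      hφ.isMorphism.regular_minimal_chart hbot hχ hy hy' l
    have hne := (hy' l).2 hl
    rw [hval] at hne
    exact unitAt_of_evalAt_div hbd hP hQ (div_ne_zero_iff.1 hne).1 hQp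
      (f := fun q => monomial ⟨l.1, mem_dualMonoid_bot l.1⟩ (χ q)) hev
  rcases hcase with ⟨hne, hτ⟩ | ⟨i, hi, hτ⟩
  · have h1 := hperp ⟨m, by rw [hτ]; exact mem_dualMonoid_bot m⟩ fun v hv =>
      pairing_eq_zero_of_mem_bot m (hτ.le hv)
    have h2 : UnitAt (fun s => ∏ i, (lform (v i) (b + s • d) ^ ((w i : ℤ) * m (u i)))⁻¹) z :=
      UnitAt.prod _ fun i _ => ((hlf i (hne i)).zpow _).inv
    exact h1.mul h2
    -- write `m = ⟨m, uᵢ⟩ m₁ + m'`, where `z^m₁` is the local equation of the divisor used for the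
    -- contact order, and `z^m'` is a unit along the divisor
  · have hp := (lform_rep_eq_zero_iff (hv.1 i) _).1 hi
    obtain ⟨ρ, hρ, S, k, hS, hcontact, hsum⟩ := hφt.2 i
    obtain rfl : ρ = ⟨ray (u i), hray i⟩ := Subtype.ext hρ
    have hSeq : S = {affineCurve hbd z} := by
      rw [← Finset.coe_inj, hS, Finset.coe_singleton]
      refine (hφ.subsingleton ⟨ray (u i), hray i⟩
        (coneDim_ray (hu i).ne_zero)).eq_singleton_of_mem ?_
      rw [hp]
      exact hv' i
    subst hSeq
    obtain ⟨x, hx, ⟨m₁, hm₁⟩, hm₁u, hord⟩ :=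
      hcontact _ (Finset.mem_singleton_self _)
    rw [Finset.sum_singleton] at hsum
    rw [hsum] at hord
    have hm₁unit : UnitAt (fun s => monomial ⟨m₁, mem_dualMonoid_bot m₁⟩ (χ (affineCurve hbd s)) *
        (lform (v i) (b + s • d) ^ (w i))⁻¹) z := by
      refine (hord.unitAt hbd (hv.1 i) hp).congr ?_
      filter_upwards [(tendsto_affineCurve hbd).eventually hχ,
        (tendsto_affineCurve hbd).eventually hx.eventually] with s e₁ e₂
      obtain ⟨hle', hxq⟩ := (isOrbitPoint_bot (χ (affineCurve hbd s))).le_and_eq (τ := ⟨⊥, hbot⟩)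
        (e₂.symm.trans e₁)
      rw [hxq, monomial_chartMap]
    have hm'unit : UnitAt (fun s => monomial ⟨m - m (u i) • m₁, mem_dualMonoid_bot _⟩
        (χ (affineCurve hbd s))) z := by
      have h0 : (m - m (u i) • m₁) (u i) = 0 := by
        simp only [LinearMap.sub_apply, LinearMap.smul_apply, smul_eq_mul, hm₁u]
        ring
      exact hperp ⟨m - m (u i) • m₁, by rw [hτ, mem_dualMonoid_ray, h0]⟩
        fun v hv => ray_perp.2 h0 v (hτ.le hv)
    have hrest : UnitAt (fun s => ∏ j ∈ Finset.univ.erase i,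
        (lform (v j) (b + s • d) ^ ((w j : ℤ) * m (u j)))⁻¹) z := by
      refine UnitAt.prod _ fun j hj => ((hlf j fun h => ?_).zpow _).inv
      exact (Finset.mem_erase.1 hj).1 (hv.eq_of_lform_eq_zero (Projectivization.rep_nonzero _) h hi)
    refine (((hm₁unit.zpow (m (u i))).mul hm'unit).mul hrest).congr (Eventually.of_forall fun s => ?_)
    have hsplit : monomial ⟨m, mem_dualMonoid_bot m⟩ (χ (affineCurve hbd s)) =
        monomial ⟨m₁, mem_dualMonoid_bot m₁⟩ (χ (affineCurve hbd s)) ^ m (u i) *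
          monomial ⟨m - m (u i) • m₁, mem_dualMonoid_bot _⟩ (χ (affineCurve hbd s)) := by
      rw [← monomial_zsmul_bot, ← monomial_add]
      congr 1
      exact Subtype.ext (add_sub_cancel _ _).symm
    rw [hsplit, ← Finset.mul_prod_erase _ _ (Finset.mem_univ i), mul_zpow, inv_zpow,
      ← zpow_natCast, ← zpow_mul]
    ring

/-- Every line of type `(u, w)` is in monomial form. The formula holds at all but finitely many points
by `exists_const_of_unitAt`; it extends to all points because both sides are regular in the smallest
chart containing the point. -/
theorem IsLine.exists_hasMonomialForm {n a : ℕ} {F : Fan n} {u : Fin a → Lat n} {w : Fin a → ℕ}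
    (hu : ∀ i, IsPrimitive (u i)) (hbal : ∑ i, w i • u i = 0)
    (hray : ∀ i, ray (u i) ∈ F.cones) (hbot : ⊥ ∈ F.cones)
    {φ : P1 → ToricVariety F} (hφ : IsLine F φ) (hφt : HasType F φ u w)
    {v : Fin a → Fin 2 → ℂ} (hv : PairwiseIndep v)
    (hv' : ∀ i, φ (Projectivization.mk ℂ (v i) (hv.1 i)) ∈ toricStratum F ⟨ray (u i), hray i⟩) :
    ∃ c : DualLat n → ℂ, HasMonomialForm F u w c v φ := by
  have horbit := hφ.exists_mem_torusOrbit hu hray hφt hv.1 hv'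
  have hex : ∀ q : P1, ∃ χ : AffineChart (⊥ : Cone n), (∀ i, lform (v i) q.rep ≠ 0) →
      φ q = ofChart F ⟨⊥, hbot⟩ χ := by
    intro q
    by_cases h : ∀ i, lform (v i) q.rep ≠ 0
    · obtain ⟨τ, ⟨y, hy, -⟩, ⟨-, hτ⟩ | ⟨i, hi, -⟩⟩ := horbit q
      · obtain ⟨τ, hτF⟩ := τ
        obtain rfl : τ = ⊥ := hτ
        exact ⟨y, fun _ => hy⟩
      · exact absurd hi (h i)
    · exact ⟨1, fun h' => absurd h' h⟩
  choose χ hχ using hex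
  have hχ' : ∀ᶠ q in cofinite, φ q = ofChart F ⟨⊥, hbot⟩ (χ q) := by
    have : ∀ᶠ q : P1 in cofinite, ∀ i, lform (v i) q.rep ≠ 0 := by
      rw [eventually_all]
      exact fun i => eventually_lform_rep_ne_zero (hv.1 i)
    exact this.mono hχ
  have hconst : ∀ m : DualLat n, ∃ c : ℂ, ∀ᶠ q in cofinite,
      monomial ⟨m, mem_dualMonoid_bot m⟩ (χ q) = c * formVal u w v m q.rep := by
    intro m
    obtain ⟨r, hr⟩ := (eventually_lform_real_ne_zero hv.1).exists
    obtain ⟨d, hd⟩ := exists_lform_ne_zero (vec_real_ne_zero r)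
    obtain ⟨c, -, hc⟩ := exists_const_of_unitAt
      (hφ.unitAt_affineCurve hu hray hbot hφt hv hv' hχ' hd m)
    refine ⟨c, eventually_of_affineCurve hd ?_⟩
    filter_upwards [hc, eventually_all.2 fun i => eventually_lform_affine_ne_zero hd (hv.1 i)] with
      s hs hs'
    obtain ⟨k, hk, hk'⟩ := exists_rep_affineCurve hd s
    rw [hk', formVal_smul hbal v m hk]
    rw [Finset.prod_inv_distrib] at hs
    exact (mul_inv_eq_iff_eq_mul₀ (formVal_ne_zero m fun i hi =>
      absurd hi (hs' i))).1 hs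
  choose c hc using hconst
  refine ⟨c, fun x hx σ hσ => ?_⟩
  set p := Projectivization.mk ℂ x hx with hp
  obtain ⟨b, hb⟩ := Projectivization.exists_smul_eq_mk_rep ℂ x hx
  rw [← hp, Units.smul_def] at hb
  obtain ⟨τ, ⟨y, hy, hy'⟩, hcase⟩ := horbit p
  have hpx : ∀ i, lform (v i) p.rep = 0 ↔ lform (v i) x = 0 := fun i => by
    rw [← hb, lform_smul_right]
    simp
  have hle : τ.1 ≤ σ.1 := by
    rcases hcase with ⟨-, h⟩ | ⟨i, hi, h⟩
    · rw [h]
      exact bot_le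
    · rw [h, ray, PointedCone.hull, Submodule.span_singleton_le_iff_mem]
      exact hσ i ((hpx i).1 hi)
  have hτ : ∀ m : dualMonoid τ.1, ∀ i, lform (v i) p.rep = 0 → 0 ≤ m.1 (u i) := by
    intro m i hi
    rcases hcase with ⟨h, -⟩ | ⟨j, hj, h⟩
    · exact absurd hi (h i)
    · obtain rfl := hv.eq_of_lform_eq_zero p.rep_nonzero hi hj
      exact dual_nonneg m.2 (h.ge (latToReal_mem_ray _))
  refine ⟨chartMap hle y, by rw [ofChart_chartMap, hy], fun m => ?_⟩
  rw [monomial_chartMap]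
  obtain ⟨k, P, Q, hP, hQ, hQp, hval, hev⟩ := hφ.isMorphism.regular_minimal_chart hbot hχ' hy hy'
    ⟨m.1, dualMonoid_anti hle m.2⟩
  rw [hval, ← formVal_smul hbal v m.1 b.ne_zero x, hb]
  -- both sides are regular at `p` and agree near `p`
  obtain ⟨d, hd⟩ := exists_lform_ne_zero p.rep_nonzero
  set e : Fin a → ℤ := fun i => (w i : ℤ) * m.1 (u i)
  set N := formPoly Finset.univ v fun i => (e i).toNat with hN
  set D := formPoly Finset.univ v fun i => (-e i).toNat with hD
  have hDp : MvPolynomial.eval p.rep D ≠ 0 := eval_formPoly_ne_zero fun i _ hi => by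
    have : 0 ≤ e i :=
      mul_nonneg (Int.natCast_nonneg (w i)) (hτ ⟨m.1, dualMonoid_anti hle m.2⟩ i hi)
    omega
  have hform : ∀ x, formVal u w v m.1 x = MvPolynomial.eval x N / MvPolynomial.eval x D :=
    fun x => prod_zpow_eq_div Finset.univ v e x
  have hpull0 : ∀ R, (pull p.rep d R).eval 0 = evalAt R p := fun R => by
    rw [eval_pull, zero_smul, add_zero, evalAt]
  have hne : ∀ R, evalAt R p ≠ 0 → pull p.rep d R ≠ 0 := fun R hR h => by
    rw [← hpull0, h] at hR
    simp at hR
  have hpoly : pull p.rep d P * pull p.rep d D =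
      Polynomial.C (c m.1) * pull p.rep d N * pull p.rep d Q := by
    apply poly_eq_of_eventually
    filter_upwards [(tendsto_affineCurve hd).eventually hev,
      (tendsto_affineCurve hd).eventually (hc m.1), eventually_eval_ne_zero (hne Q hQp),
      eventually_eval_ne_zero (hne D hDp)] with s e₁ e₂ e₃ e₄
    obtain ⟨k', hk, hk'⟩ := exists_rep_affineCurve hd s
    rw [e₁, evalAt_div_affineCurve hd hP hQ, hk', formVal_smul hbal v m.1 hk, hform, ← eval_pull,
      ← eval_pull, mul_div_assoc', div_eq_div_iff e₃ e₄] at e₂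
    simpa only [Polynomial.eval_mul, Polynomial.eval_C] using e₂
  have h0 := congrArg (Polynomial.eval 0) hpoly
  simp only [Polynomial.eval_mul, Polynomial.eval_C, hpull0] at h0
  rw [hform, mul_div_assoc', div_eq_div_iff hQp hDp]
  exact h0

/-! ### Characters of the real torus -/

theorem torusChar_tmul {n : ℕ} (m : DualLat n) (u : Lat n) (r : ℝˣ) :
    torusChar m (u ⊗ₜ[ℤ] Additive.ofMul r) = r ^ m u := by
  simp [torusChar]

theorem torusChar_add_right {n : ℕ} (m : DualLat n) (s t : RealTorus n) :
    torusChar m (s + t) = torusChar m s * torusChar m t := by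
  simp [torusChar]

theorem torusChar_zero_right {n : ℕ} (m : DualLat n) : torusChar m (0 : RealTorus n) = 1 := by
  simp [torusChar]

theorem torusChar_sum_right {n : ℕ} {ι : Type*} (m : DualLat n) (s : Finset ι)
    (t : ι → RealTorus n) : torusChar m (∑ i ∈ s, t i) = ∏ i ∈ s, torusChar m (t i) := by
  classical
  induction s using Finset.induction_on with
  | empty => simp [torusChar_zero_right]
  | insert i s hi ih => rw [Finset.sum_insert hi, Finset.prod_insert hi, torusChar_add_right, ih]

/-- An element of the torus is determined by the values of the coordinate characters. -/
theorem eq_sum_torusChar {n : ℕ} (t : RealTorus n) :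
    t = ∑ i, (Pi.single i 1 : Lat n) ⊗ₜ[ℤ] Additive.ofMul (torusChar (LinearMap.proj i) t) := by
  induction t using TensorProduct.induction_on with
  | zero => simp [torusChar_zero_right]
  | add s t hs ht =>
    conv_lhs => rw [hs, ht]
    simp only [torusChar_add_right, ofMul_mul, TensorProduct.tmul_add, Finset.sum_add_distrib]
  | tmul u r =>
    have h : ∀ i, (Pi.single i 1 : Lat n) ⊗ₜ[ℤ] Additive.ofMul (torusChar (LinearMap.proj i)
        (u ⊗ₜ[ℤ] r)) = (u i • Pi.single i 1 : Lat n) ⊗ₜ[ℤ] r := by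
      intro i
      have := torusChar_tmul (LinearMap.proj i) u (Additive.toMul r)
      rw [ofMul_toMul] at this
      rw [this, ofMul_zpow, ofMul_toMul, LinearMap.proj_apply, TensorProduct.smul_tmul]
    simp only [h]
    rw [← TensorProduct.sum_tmul]
    congr 1
    ext j
    simp [Finset.sum_apply, Pi.single_apply]

theorem torus_ext {n : ℕ} {s t : RealTorus n} (h : ∀ m, torusChar m s = torusChar m t) : s = t := by
  rw [eq_sum_torusChar s, eq_sum_torusChar t]
  simp only [h]

/-- Every homomorphism from the monomials to `ℝ^×` is the evaluation at a point of the torus. -/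
theorem exists_torusChar_eq {n : ℕ} {c : DualLat n → ℝˣ} (hc : ∀ m m', c (m + m') = c m * c m') :
    ∃ t : RealTorus n, ∀ m, torusChar m t = c m := by
  let C : DualLat n →+ Additive ℝˣ := AddMonoidHom.mk' (fun m => Additive.ofMul (c m)) fun m m' => by
    rw [hc, ofMul_mul]
  refine ⟨∑ i, (Pi.single i 1 : Lat n) ⊗ₜ[ℤ] Additive.ofMul (c (LinearMap.proj i)), fun m => ?_⟩
  rw [torusChar_sum_right]
  simp only [torusChar_tmul]
  have hm : m = ∑ i, m (Pi.single i 1) • (LinearMap.proj i : DualLat n) := by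
    refine LinearMap.pi_ext' fun j => LinearMap.ext_ring ?_
    simp [Pi.single_apply]
  have h1 := congrArg C hm
  rw [map_sum] at h1
  simp only [map_zsmul] at h1
  exact (Additive.ofMul.injective h1).symm

/-- The kernel of `M ⊗ ℝ^× → (M / ℤ u) ⊗ ℝ^×` is `ℤ u ⊗ ℝ^×`. -/
theorem torusProj_eq_zero_iff {n : ℕ} (u : Lat n) (t : RealTorus n) :
    torusProj u t = 0 ↔ ∃ r : ℝˣ, t = u ⊗ₜ[ℤ] Additive.ofMul r := by
  constructor
  · intro h
    have hex : Function.Exact (Submodule.span ℤ {u}).subtype (Submodule.span ℤ {u}).mkQ :=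
      LinearMap.exact_subtype_mkQ _
    obtain ⟨s, rfl⟩ := (rTensor_exact (Additive ℝˣ) hex (Submodule.mkQ_surjective _) t).1 h
    clear h
    induction s using TensorProduct.induction_on with
    | zero => exact ⟨1, by simp⟩
    | add s t hs ht =>
      obtain ⟨r, hr⟩ := hs
      obtain ⟨r', hr'⟩ := ht
      exact ⟨r * r', by rw [map_add, hr, hr', ofMul_mul, TensorProduct.tmul_add]⟩
    | tmul v r =>
      obtain ⟨v, hv⟩ := v
      obtain ⟨k, rfl⟩ := Submodule.mem_span_singleton.1 hv
      refine ⟨Additive.toMul r ^ k, ?_⟩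
      rw [LinearMap.rTensor_tmul, ofMul_zpow, ofMul_toMul, Submodule.subtype_apply,
        TensorProduct.smul_tmul]
  · rintro ⟨r, rfl⟩
    have : (Submodule.span ℤ {u}).mkQ u = 0 := by
      rw [Submodule.mkQ_apply, Submodule.Quotient.mk_eq_zero]
      exact Submodule.mem_span_singleton_self u
    have h := LinearMap.rTensor_tmul (Additive ℝˣ) (Submodule.span ℤ {u}).mkQ (Additive.ofMul r) u
    rw [this, TensorProduct.zero_tmul] at h
    exact h

/-- An action whose stabilizers are all equal to the kernel of a surjective homomorphism factors
over it. -/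
theorem exists_factor_action {G H X : Type*} [AddCommGroup G] [AddCommGroup H] (π : G → H)
    (hπ : ∀ g g', π (g + g') = π g + π g') (hsurj : Function.Surjective π) (act : AddAction G X)
    (htrans : ∀ x y : X, ∃ g, act.vadd g x = y)
    (hstab : ∀ g x, act.vadd g x = x ↔ π g = 0) :
    ∃ act' : AddAction H X, (∀ g x, act.vadd g x = act'.vadd (π g) x) ∧
      ∀ x y : X, ∃! h, act'.vadd h x = y := by
  have hadd : ∀ g g' x, act.vadd (g + g') x = act.vadd g (act.vadd g' x) := act.add_vadd
  have hzero : ∀ x, act.vadd 0 x = x := act.zero_vadd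
  let f : G →+ H := AddMonoidHom.mk' π hπ
  have key : ∀ g g' x, act.vadd g x = act.vadd g' x ↔ π g = π g' := by
    intro g g' x
    have h1 : act.vadd g x = act.vadd (g - g') (act.vadd g' x) := by
      rw [← hadd, sub_add_cancel]
    rw [h1, hstab]
    change f (g - g') = 0 ↔ f g = f g'
    rw [map_sub, sub_eq_zero]
  choose s hs using hsurj
  let act' : AddAction H X :=
    { vadd := fun h x => act.vadd (s h) x
      zero_vadd := fun x => by
        change act.vadd (s 0) x = x
        rw [hstab, hs]
      add_vadd := fun h h' x => by
        change act.vadd (s (h + h')) x = act.vadd (s h) (act.vadd (s h') x)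
        rw [← hadd, key, hπ, hs, hs, hs] }
  refine ⟨act', fun g x => (key _ _ x).2 (hs _).symm, fun x y => ?_⟩
  obtain ⟨g, hg⟩ := htrans x y
  refine ⟨π g, ((key _ _ x).2 (hs _)).trans hg, fun h hh => ?_⟩
  have h1 : act.vadd (s h) x = act.vadd g x := Eq.trans hh hg.symm
  rw [key, hs] at h1
  exact h1

theorem torusTranslate_zero {n : ℕ} (F : Fan n) (p : ToricVariety F) :
    torusTranslate F 0 p = p := by
  induction p using Quotient.inductionOn with
  | h a =>
  obtain ⟨σ, x⟩ := a
  change ofChart F σ (chartTranslate 0 σ.1 x) = ofChart F σ x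
  congr 1
  refine chart_ext fun m => ?_
  change (((torusChar m.1 0 : ℝˣ) : ℝ) : ℂ) * monomial m x = monomial m x
  simp [torusChar_zero_right]

theorem torusTranslate_add {n : ℕ} (F : Fan n) (s t : RealTorus n) (p : ToricVariety F) :
    torusTranslate F (s + t) p = torusTranslate F s (torusTranslate F t p) := by
  induction p using Quotient.inductionOn with
  | h a =>
  obtain ⟨σ, x⟩ := a
  change ofChart F σ (chartTranslate (s + t) σ.1 x) =
    ofChart F σ (chartTranslate s σ.1 (chartTranslate t σ.1 x))
  congr 1
  refine chart_ext fun m => ?_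
  change (((torusChar m.1 (s + t) : ℝˣ) : ℝ) : ℂ) * monomial m x =
    (((torusChar m.1 s : ℝˣ) : ℝ) : ℂ) * ((((torusChar m.1 t : ℝˣ) : ℝ) : ℂ) * monomial m x)
  rw [torusChar_add_right, Units.val_mul, Complex.ofReal_mul, mul_assoc]

/-! ### Real lines -/

/-- A point of the projective line fixed by complex conjugation has real homogeneous coordinates. -/
theorem exists_real_vec {p : P1} (hp : conjP1 p = p) :
    ∃ (v : Fin 2 → ℂ) (hv : v ≠ 0), star v = v ∧ p = Projectivization.mk ℂ v hv := by
  induction p using Projectivization.ind with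
  | h x hx =>
  rw [conjP1_mk hx] at hp
  obtain ⟨c, hc⟩ := (Projectivization.mk_eq_mk_iff ℂ _ _ _ _).1 hp
  rw [Units.smul_def] at hc
  have h0 : star (x 0) = c * x 0 := (congrFun hc 0).symm
  have h1 : star (x 1) = c * x 1 := (congrFun hc 1).symm
  -- divide by a nonzero coordinate
  obtain ⟨i, hi⟩ : ∃ i, x i ≠ 0 := by
    by_contra! h
    exact hx (funext h)
  have hreal : star ((x i)⁻¹ • x) = (x i)⁻¹ • x := by
    have hall : ∀ j, star (x j) = c * x j := fun j => by fin_cases j <;> assumption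
    ext j
    have hc0 := c.ne_zero
    simp only [Pi.star_apply, Pi.smul_apply, smul_eq_mul, star_mul', star_inv₀, hall]
    field_simp
  refine ⟨(x i)⁻¹ • x, smul_ne_zero (inv_ne_zero hi) hx, hreal, ?_⟩
  rw [Projectivization.mk_eq_mk_iff]
  refine ⟨Units.mk0 (x i) hi, ?_⟩
  rw [Units.smul_mk0, smul_smul, mul_inv_cancel₀ hi, one_smul]

theorem toricConj_mem_toricStratum {n : ℕ} {F : Fan n} {ρ : F.cones} {p : ToricVariety F}
    (hp : p ∈ toricStratum F ρ) : toricConj F p ∈ toricStratum F ρ := by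
  obtain ⟨τ, hle, y, rfl, hy⟩ := hp
  refine ⟨τ, hle, (starRingEnd ℂ : ℂ →* ℂ).comp y, rfl, fun m => ?_⟩
  rw [← hy m]
  change star (monomial m y) ≠ 0 ↔ _
  rw [ne_eq, star_eq_zero]

/-- The coefficients of a map in monomial form are a homomorphism to `ℂ^×`. -/
theorem HasMonomialForm.coeff_ne_zero_and_add {n a : ℕ} {F : Fan n} {u : Fin a → Lat n} {w : Fin a → ℕ}
    (hw : ∀ i, 0 < w i) (hbot : ⊥ ∈ F.cones) {v : Fin a → Fin 2 → ℂ} (hv : PairwiseIndep v)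
    {c : DualLat n → ℂ} {φ : P1 → ToricVariety F} (hφ : HasMonomialForm F u w c v φ) :
    (∀ m, c m ≠ 0) ∧ ∀ m m', c (m + m') = c m * c m' := by
  obtain ⟨r, hr⟩ := (eventually_lform_real_ne_zero hv.1).exists
  obtain ⟨y, -, hy⟩ := hφ _ (vec_real_ne_zero r) ⟨⊥, hbot⟩ (supports_of_forall_ne_zero hr _)
  have hvan : ∀ (m : DualLat n) i, lform (v i) ![(r : ℂ), 1] = 0 → m (u i) = 0 := fun m i hi =>
    absurd hi (hr i)
  constructor
  · intro m
    have h1 := hy ⟨m, mem_dualMonoid_bot m⟩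
    have h2 := monomial_ne_zero_of_perp ⟨m, mem_dualMonoid_bot m⟩
      (fun v hv => pairing_eq_zero_of_mem_bot m hv) y
    rw [h1] at h2
    exact left_ne_zero_of_mul h2
  · intro m m'
    have h1 := monomial_add ⟨m, mem_dualMonoid_bot m⟩ ⟨m', mem_dualMonoid_bot m'⟩ y
    have h2 := hy ⟨m + m', mem_dualMonoid_bot _⟩
    rw [hy ⟨m, mem_dualMonoid_bot m⟩, hy ⟨m', mem_dualMonoid_bot m'⟩] at h1
    have h3 := h2.symm.trans h1
    simp only at h3
    rw [formVal_add hw (fun i hi => absurd hi (hr i)) (fun i hi => absurd hi (hr i))] at h3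
    refine mul_right_cancel₀ (mul_ne_zero (formVal_ne_zero m (hvan m))
      (formVal_ne_zero m' (hvan m'))) (h3.trans ?_)
    ring

/-- The coefficients of a real map are real: evaluate at a real point of the big torus. -/
theorem HasMonomialForm.coeff_real {n a : ℕ} {F : Fan n} {u : Fin a → Lat n} {w : Fin a → ℕ}
    (hbot : ⊥ ∈ F.cones) {v : Fin a → Fin 2 → ℂ} (hv : PairwiseIndep v)
    (hvreal : ∀ i, star (v i) = v i) {c : DualLat n → ℂ} {φ : P1 → ToricVariety F}
    (hφ : HasMonomialForm F u w c v φ) (hφr : IsRealMap F φ) (m : DualLat n) : star (c m) = c m := by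
  obtain ⟨r, hr⟩ := (eventually_lform_real_ne_zero hv.1).exists
  obtain ⟨y, hy, hy'⟩ := hφ _ (vec_real_ne_zero r) ⟨⊥, hbot⟩ (supports_of_forall_ne_zero hr _)
  have hstar : star ![(r : ℂ), 1] = ![(r : ℂ), 1] := by
    ext i
    fin_cases i <;> simp
  have h1 := hφr (Projectivization.mk ℂ _ (vec_real_ne_zero r))
  rw [conjP1_mk] at h1
  simp only [hstar, hy] at h1
  have h2 : y = (starRingEnd ℂ : ℂ →* ℂ).comp y := ofChart_injective h1
  have h3 : monomial ⟨m, mem_dualMonoid_bot m⟩ y = star (monomial ⟨m, mem_dualMonoid_bot m⟩ y) :=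
    congrArg (fun z : AffineChart (⊥ : Cone n) => monomial ⟨m, mem_dualMonoid_bot m⟩ z) h2
  have hform : star (formVal u w v m ![(r : ℂ), 1]) = formVal u w v m ![(r : ℂ), 1] := by
    rw [formVal, star_prod]
    refine Finset.prod_congr rfl fun i _ => ?_
    rw [star_zpow₀, ← lform_star (hvreal i), hstar]
  rw [hy', star_mul', hform] at h3
  exact (mul_right_cancel₀ (formVal_ne_zero m fun i hi => absurd hi (hr i)) h3).symm

/-- The values of the characters `z^m` at a point of the real torus, as complex numbers. -/
noncomputable abbrev torusCoeff {n : ℕ} (t : RealTorus n) (m : DualLat n) : ℂ := ((torusChar m t : ℝˣ) : ℝ)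

theorem torusCoeff_ne_zero {n : ℕ} (t : RealTorus n) (m : DualLat n) : torusCoeff t m ≠ 0 := by
  simp [torusCoeff]

theorem torusCoeff_injective {n : ℕ} : Function.Injective (torusCoeff (n := n)) := by
  intro s t h
  refine torus_ext fun m => Units.ext ?_
  exact_mod_cast congrFun h m

/-- Every real line is given by real linear forms and real coefficients. -/
theorem RealLine.exists_form {n a : ℕ} {F : Fan n} {u : Fin a → Lat n} {w : Fin a → ℕ}
    (hu : ∀ i, IsPrimitive (u i)) (hw : ∀ i, 0 < w i) (hbal : ∑ i, w i • u i = 0)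
    (hinj : Function.Injective u) (hray : ∀ i, ray (u i) ∈ F.cones) (hbot : ⊥ ∈ F.cones)
    (φ : RealLine F u w) : ∃ (v : Fin a → Fin 2 → ℂ) (t : RealTorus n), PairwiseIndep v ∧
      (∀ i, star (v i) = v i) ∧ HasMonomialForm F u w (torusCoeff t) v φ.1 := by
  obtain ⟨φ, hφ, hφr, hφt⟩ := φ
  have hdim : ∀ i, coneDim (ray (u i)) = 1 := fun i => coneDim_ray (hu i).ne_zero
  have hpt : ∀ i, ∃ (v : Fin 2 → ℂ) (hv : v ≠ 0), star v = v ∧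
      φ (Projectivization.mk ℂ v hv) ∈ toricStratum F ⟨ray (u i), hray i⟩ := by
    intro i
    obtain ⟨p, hp⟩ := (hφt.1 ⟨ray (u i), hray i⟩ (hdim i)).2 ⟨i, rfl⟩
    have hp' : conjP1 p ∈ φ ⁻¹' toricStratum F ⟨ray (u i), hray i⟩ := by
      rw [Set.mem_preimage, hφr]
      exact toricConj_mem_toricStratum hp
    obtain ⟨v, hv, hvr, rfl⟩ := exists_real_vec
      (hφ.subsingleton ⟨ray (u i), hray i⟩ (hdim i) hp' hp)
    exact ⟨v, hv, hvr, hp⟩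
  choose v hv hvr hv' using hpt
  have hind : PairwiseIndep v := by
    refine ⟨hv, fun i j hij => ?_⟩
    -- a common point of two divisors would lie on a stratum of codimension greater than one
    have hp : Projectivization.mk ℂ (v j) (hv j) = Projectivization.mk ℂ (v i) (hv i) := by
      obtain ⟨c, hc, h⟩ := exists_smul_eq_of_lform_eq_zero (hv i) (hv j) hij
      rw [Projectivization.mk_eq_mk_iff]
      exact ⟨Units.mk0 c hc, h.symm⟩
    obtain ⟨τ, hle, hτ⟩ := hv' i
    obtain ⟨τ', hle', hτ'⟩ := hv' j
    rw [hp] at hτ'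
    obtain rfl := torusOrbit_disjoint hτ hτ'
    have h1 : coneDim τ.1 ≤ 1 := by
      by_contra! h
      exact hφ.transverse.2 τ h _ ⟨τ, le_rfl, hτ⟩
    have hconv := F.stronglyConvex τ.1 τ.2
    exact hinj (ray_injective (hu i) (hu j)
      ((eq_ray_of_ray_le hconv (hu i).ne_zero hle h1).symm.trans
        (eq_ray_of_ray_le hconv (hu j).ne_zero hle' h1)))
  obtain ⟨c, hc⟩ := hφ.exists_hasMonomialForm hu hbal hray hbot hφt hind hv'
  obtain ⟨hc0, hcadd⟩ := hc.coeff_ne_zero_and_add hw hbot hind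
  have hcr := hc.coeff_real hbot hind hvr hφr
  have hre : ∀ m, (((c m).re : ℝ) : ℂ) = c m := fun m => Complex.conj_eq_iff_re.1 (hcr m)
  have hre0 : ∀ m, (c m).re ≠ 0 := fun m h => hc0 m (by rw [← hre, h, Complex.ofReal_zero])
  obtain ⟨t, ht⟩ := exists_torusChar_eq (c := fun m => Units.mk0 (c m).re (hre0 m)) fun m m' => by
    apply Units.ext
    change (c (m + m')).re = (c m).re * (c m').re
    have : (((c (m + m')).re : ℝ) : ℂ) = ((c m).re * (c m').re : ℝ) := by
      rw [Complex.ofReal_mul, hre, hre, hre, hcadd]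
    exact_mod_cast this
  refine ⟨v, t, hind, hvr, ?_⟩
  have : torusCoeff t = c := by
    ext m
    rw [torusCoeff, ht, Units.val_mk0, hre]
  rw [this]
  exact hc

/-! ### Normal forms and isomorphisms of real lines -/

/-- The points `[1 : 0]`, `[0 : 1]` and `[1 : 1]`. -/
def stdVec {a : ℕ} (i : Fin a) : Fin 2 → ℂ :=
  if i.val = 0 then ![1, 0] else if i.val = 1 then ![0, 1] else ![1, 1]

theorem star_stdVec {a : ℕ} (i : Fin a) : star (stdVec i) = stdVec i := by
  unfold stdVec
  split_ifs <;> · ext j; fin_cases j <;> simp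

theorem pairwiseIndep_stdVec {a : ℕ} (ha : a = 2 ∨ a = 3) :
    PairwiseIndep (stdVec : Fin a → Fin 2 → ℂ) := by
  constructor
  · intro i h
    have h0 := congrFun h 0
    have h1 := congrFun h 1
    unfold stdVec at h0 h1
    split_ifs at h0 h1 <;> simp at h0 h1
  · rcases ha with rfl | rfl
    · intro i j h
      fin_cases i <;> fin_cases j <;> simp [stdVec, lform] at h ⊢
    · intro i j h
      fin_cases i <;> fin_cases j <;> simp [stdVec, lform] at h ⊢

/-- Two linearly independent vectors are the columns of an automorphism of `ℂ²`. -/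
theorem exists_gl_smul_eq {p q : Fin 2 → ℂ} (h : lform p q ≠ 0) :
    ∃ g : LinearMap.GeneralLinearGroup ℂ (Fin 2 → ℂ), ∀ x, g • x = x 0 • p + x 1 • q := by
  have hdet : (!![p 0, q 0; p 1, q 1] : Matrix (Fin 2) (Fin 2) ℂ).det ≠ 0 := by
    rw [Matrix.det_fin_two_of]
    intro h0
    apply h
    rw [lform]
    linear_combination -h0
  refine ⟨Matrix.GeneralLinearGroup.toLin (Matrix.GeneralLinearGroup.mkOfDetNeZero _ hdet),
    fun x => ?_⟩
  change Matrix.toLin' !![p 0, q 0; p 1, q 1] x = _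
  ext i
  fin_cases i <;> simp [Matrix.toLin'_apply, Matrix.mulVec, dotProduct] <;> ring

/-- At most three pairwise distinct real points can be moved to the standard ones by a projective
transformation with real coefficients. -/
theorem exists_gl_smul_stdVec {a : ℕ} (ha : a = 2 ∨ a = 3) {v : Fin a → Fin 2 → ℂ}
    (hv : PairwiseIndep v) (hvreal : ∀ i, star (v i) = v i) :
    ∃ (g : LinearMap.GeneralLinearGroup ℂ (Fin 2 → ℂ)) (b : Fin a → ℝˣ),
      ∀ i, g • stdVec i = (((b i : ℝˣ) : ℝ) : ℂ) • v i := by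
  have hreal : ∀ i j, i ≠ j → ∃ r : ℝˣ, ((r : ℝ) : ℂ) = lform (v i) (v j) := by
    intro i j hij
    have h1 : (starRingEnd ℂ) (lform (v i) (v j)) = lform (v i) (v j) := by
      change star _ = _
      rw [← lform_star (hvreal i), hvreal j]
    have h2 := Complex.conj_eq_iff_re.1 h1
    refine ⟨Units.mk0 (lform (v i) (v j)).re fun h => hij (hv.2 i j ?_), h2⟩
    rw [← h2, h, Complex.ofReal_zero]
  rcases ha with rfl | rfl
  · obtain ⟨g, hg⟩ := exists_gl_smul_eq (p := v 0) (q := v 1)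
      fun h => absurd (hv.2 0 1 h) (by decide)
    refine ⟨g, 1, fun i => ?_⟩
    rw [hg]
    fin_cases i <;> simp [stdVec]
  · obtain ⟨r₀, h₀⟩ := hreal 2 1 (by decide)
    obtain ⟨r₁, h₁⟩ := hreal 0 2 (by decide)
    obtain ⟨r₂, h₂⟩ := hreal 0 1 (by decide)
    -- Cramer's rule expresses `v 2` in terms of `v 0` and `v 1`
    obtain ⟨g, hg⟩ := exists_gl_smul_eq (p := ((r₀ : ℝ) : ℂ) • v 0) (q := ((r₁ : ℝ) : ℂ) • v 1) (by
      rw [lform_smul_left, lform_smul_right]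
      refine mul_ne_zero ?_ (mul_ne_zero ?_ fun h => absurd (hv.2 0 1 h) (by decide))
      · exact_mod_cast r₀.ne_zero
      · exact_mod_cast r₁.ne_zero)
    refine ⟨g, ![r₀, r₁, r₂], fun i => ?_⟩
    rw [hg]
    have h := lform_smul_eq (v 0) (v 1) (v 2)
    rw [← h₀, ← h₁, ← h₂] at h
    fin_cases i
    · simp [stdVec]
    · simp [stdVec]
    · simpa [stdVec] using h.symm

/-- The hypotheses on the fan, the rays and the weights under which real lines are classified. -/
structure LineData {n a : ℕ} (F : Fan n) (u : Fin a → Lat n) (w : Fin a → ℕ) : Prop where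
  card : a = 2 ∨ a = 3
  primitive : ∀ i, IsPrimitive (u i)
  pos : ∀ i, 0 < w i
  balanced : ∑ i, w i • u i = 0
  injective : Function.Injective u
  ray_mem : ∀ i, ray (u i) ∈ F.cones

namespace LineData

variable {n a : ℕ} {F : Fan n} {u : Fin a → Lat n} {w : Fin a → ℕ}

theorem bot_mem (D : LineData F u w) : ⊥ ∈ F.cones := by
  have ha : 0 < a := by rcases D.card with h | h <;> omega
  exact bot_mem_cones F (D.primitive ⟨0, ha⟩) (D.ray_mem _)

/-- A real line in normal form: it meets the divisors at the standard points. -/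
def IsStd (t : RealTorus n) (φ : P1 → ToricVariety F) (u : Fin a → Lat n) (w : Fin a → ℕ) : Prop :=
  HasMonomialForm F u w (torusCoeff t) stdVec φ

theorem realLine_of_form (D : LineData F u w) {v : Fin a → Fin 2 → ℂ} (hv : PairwiseIndep v)
    (hvreal : ∀ i, star (v i) = v i) {t : RealTorus n} {φ : P1 → ToricVariety F}
    (hφ : HasMonomialForm F u w (torusCoeff t) v φ) :
    IsLine F φ ∧ IsRealMap F φ ∧ HasType F φ u w := by
  refine ⟨hφ.isLine (by rcases D.card with h | h <;> omega) (by rcases D.card with h | h <;> omega)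
    D.pos D.primitive D.injective D.balanced D.bot_mem D.ray_mem hv,
    hφ.isRealMap D.bot_mem D.ray_mem hv hvreal fun m => Complex.conj_ofReal _,
    hφ.hasType D.pos D.primitive D.injective D.balanced D.bot_mem D.ray_mem hv
      (torusCoeff_ne_zero t)⟩

theorem exists_isStd (D : LineData F u w) (t : RealTorus n) :
    ∃ φ : RealLine F u w, IsStd t φ.1 u w := by
  obtain ⟨φ, hφ⟩ := exists_hasMonomialForm (F := F) D.pos D.balanced D.bot_mem D.ray_mem
    (pairwiseIndep_stdVec D.card) (c := torusCoeff t)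
    (by simp [torusCoeff, torusChar_zero]) (fun m m' => by simp [torusCoeff, torusChar_add])
  exact ⟨⟨φ, D.realLine_of_form (pairwiseIndep_stdVec D.card) star_stdVec hφ⟩, hφ⟩

theorem exists_torusTranslate (D : LineData F u w) (t : RealTorus n) (φ : RealLine F u w) :
    ∃ ψ : RealLine F u w, ∀ p, ψ.1 p = torusTranslate F t (φ.1 p) := by
  obtain ⟨v, s, hv, hvr, hφ⟩ := φ.exists_form D.primitive D.pos D.balanced D.injective D.ray_mem
    D.bot_mem
  have h : HasMonomialForm F u w (torusCoeff (t + s)) v (fun p => torusTranslate F t (φ.1 p)) := by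
    convert hφ.torusTranslate t using 2 with m
    simp [torusCoeff, torusChar_add_right]
  exact ⟨⟨_, D.realLine_of_form hv hvr h⟩, fun p => rfl⟩

theorem isStd_translate {s t : RealTorus n} {φ ψ : P1 → ToricVariety F}
    (hφ : IsStd s φ u w) (hψ : ∀ p, ψ p = torusTranslate F t (φ p)) : IsStd (t + s) ψ u w := by
  obtain rfl : ψ = fun p => torusTranslate F t (φ p) := funext hψ
  unfold IsStd at hφ ⊢
  convert hφ.torusTranslate t using 2 with m
  simp [torusCoeff, torusChar_add_right]

/-- Every isomorphism class of real lines contains one in normal form. -/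
theorem exists_equiv_isStd (D : LineData F u w) (φ : RealLine F u w) :
    ∃ (t : RealTorus n) (ψ : RealLine F u w), IsStd t ψ.1 u w ∧ φ ≈ ψ := by
  obtain ⟨v, s, hv, hvr, hφ⟩ := φ.exists_form D.primitive D.pos D.balanced D.injective D.ray_mem
    D.bot_mem
  obtain ⟨g, b, hg⟩ := exists_gl_smul_stdVec D.card hv hvr
  have h := hφ.comp_smul D.balanced g (fun i => by simp) hg
  have h' : HasMonomialForm F u w
      (torusCoeff (s + ∑ i, (w i • u i) ⊗ₜ[ℤ] Additive.ofMul (b i)⁻¹)) stdVec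
      (fun q => φ.1 (g • q)) := by
    convert h using 2 with m
    simp only [torusCoeff, torusChar_add_right, torusChar_sum_right, torusChar_tmul, map_nsmul]
    push_cast
    simp only [nsmul_eq_mul]
  exact ⟨_, ⟨_, D.realLine_of_form (pairwiseIndep_stdVec D.card) star_stdVec h'⟩, h', g,
    fun p => rfl⟩

/-- An isomorphism of real lines in normal form fixes the standard points, and it relates the
coefficients by its eigenvalues there. -/
theorem torusCoeff_of_equiv (D : LineData F u w) {s t : RealTorus n} {φ ψ : RealLine F u w}
    (hφ : IsStd s φ.1 u w) (hψ : IsStd t ψ.1 u w) (h : φ ≈ ψ) :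
    ∃ (g : LinearMap.GeneralLinearGroup ℂ (Fin 2 → ℂ)) (b : Fin a → ℂ), (∀ i, b i ≠ 0) ∧
      (∀ i : Fin a, g • stdVec i = b i • (stdVec i : Fin 2 → ℂ)) ∧
      ∀ m, torusCoeff t m = torusCoeff s m * ∏ i, (b i)⁻¹ ^ ((w i : ℤ) * m (u i)) := by
  obtain ⟨g, hg⟩ := h
  have hstd := pairwiseIndep_stdVec D.card
  have hb : ∀ i : Fin a, ∃ b : ℂ, b ≠ 0 ∧ g • stdVec i = b • (stdVec i : Fin 2 → ℂ) := by
    intro i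
    have hdim : 0 < coneDim (ray (u i)) := by
      rw [coneDim_ray (D.primitive i).ne_zero]; exact one_pos
    have h1 := (HasMonomialForm.mem_toricStratum_iff D.pos D.bot_mem D.ray_mem hstd hψ
      (Projectivization.mk ℂ (stdVec i) (hstd.1 i)) (ρ := ⟨ray (u i), D.ray_mem i⟩) hdim).2
      ⟨i, lform_mk_rep (hstd.1 i), rfl⟩
    rw [← hg] at h1
    obtain ⟨j, hj, hij⟩ := (HasMonomialForm.mem_toricStratum_iff D.pos D.bot_mem D.ray_mem hstd hφ
      _ (ρ := ⟨ray (u i), D.ray_mem i⟩) hdim).1 h1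
    obtain rfl := D.injective (ray_injective (D.primitive i) (D.primitive j) hij)
    rw [lform_rep_eq_zero_iff (hstd.1 i), Projectivization.smul_mk,
      Projectivization.mk_eq_mk_iff] at hj
    obtain ⟨b, hb⟩ := hj
    exact ⟨b, b.ne_zero, hb.symm⟩
  choose b hb0 hb using hb
  refine ⟨g, b, hb0, hb, fun m => ?_⟩
  have h1 := HasMonomialForm.comp_smul D.balanced hφ g hb0 hb
  have h2 : (fun q => φ.1 (g • q)) = ψ.1 := funext hg
  rw [h2] at h1
  exact congrFun (HasMonomialForm.coeff_unique D.bot_mem hstd hψ h1) m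

theorem eq_of_equiv_of_card_three (D : LineData F u w) (ha : a = 3) {s t : RealTorus n}
    {φ ψ : RealLine F u w} (hφ : IsStd s φ.1 u w) (hψ : IsStd t ψ.1 u w) (h : φ ≈ ψ) : s = t := by
  subst ha
  obtain ⟨g, b, hb0, hb, hcoeff⟩ := D.torusCoeff_of_equiv hφ hψ h
  -- an automorphism of the projective line fixing three points is the identity
  have hb' : ∀ i, b i = b 2 * 1 := by
    have h0 : (stdVec (2 : Fin 3)) = stdVec (0 : Fin 3) + stdVec (1 : Fin 3) := by
      ext i
      fin_cases i <;> simp [stdVec]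
    have h1 := hb 2
    rw [h0, smul_add, hb 0, hb 1] at h1
    have h2 := congrFun h1 0
    have h3 := congrFun h1 1
    simp [stdVec] at h2 h3
    intro i
    fin_cases i <;> simp [h2, h3]
  have hbinv : ∀ i, (b i)⁻¹ = (b 2)⁻¹ * 1 := fun i => by rw [hb' i]; simp
  refine torusCoeff_injective (funext fun m => ?_)
  rw [hcoeff m, Finset.prod_congr rfl fun i _ => by rw [hbinv i], formVal_prod_smul D.balanced m (inv_ne_zero (hb0 2))]
  simp

/-- With two divisors, balancing and primitivity make the rays opposite and the weights equal. -/
theorem neg_of_card_two {u : Fin 2 → Lat n} {w : Fin 2 → ℕ} (D : LineData F u w) :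
    u 1 = - u 0 ∧ w 1 = w 0 := by
  obtain ⟨m₀, h₀⟩ := (D.primitive 0).exists_dual_eq_one
  obtain ⟨m₁, h₁⟩ := (D.primitive 1).exists_dual_eq_one
  have e₀ := sum_weights_eq_zero D.balanced m₀
  have e₁ := sum_weights_eq_zero D.balanced m₁
  rw [Fin.sum_univ_two] at e₀ e₁
  rw [h₀] at e₀
  rw [h₁] at e₁
  have hw : (w 1 : ℤ) = w 0 := by
    refine Int.dvd_antisymm (by positivity) (by positivity) ⟨-m₀ (u 1), by linarith⟩
      ⟨-m₁ (u 0), by linarith⟩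
  have hw' : w 1 = w 0 := by exact_mod_cast hw
  refine ⟨?_, hw'⟩
  have hb := D.balanced
  rw [Fin.sum_univ_two, hw', ← smul_add] at hb
  have h2 : u 0 + u 1 = 0 := (smul_eq_zero.1 hb).resolve_left (D.pos 0).ne'
  exact (neg_eq_of_add_eq_zero_right h2).symm

/-- With two divisors, the translate of a real line in normal form is isomorphic to the line exactly if
the translation is by an element of `ℤ u₀ ⊗ ℝ^×`. -/
theorem equiv_iff_of_card_two {u : Fin 2 → Lat n} {w : Fin 2 → ℕ} (D : LineData F u w)
    {s t : RealTorus n} {φ ψ : RealLine F u w} (hφ : IsStd t φ.1 u w)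
    (hψ : IsStd (s + t) ψ.1 u w) :
    φ ≈ ψ ↔ ∃ r : ℝˣ, s = u 0 ⊗ₜ[ℤ] Additive.ofMul r := by
  obtain ⟨hu1, hw1⟩ := D.neg_of_card_two
  constructor
  · intro h
    obtain ⟨g, b, hb0, hb, hcoeff⟩ := D.torusCoeff_of_equiv hφ hψ h
    have hs : ∀ m, torusCoeff s m = ((b 1 * (b 0)⁻¹) ^ w 0) ^ m (u 0) := by
      intro m
      have h1 := hcoeff m
      rw [Fin.prod_univ_two, hu1, hw1, map_neg, mul_neg, zpow_neg, ← inv_zpow, inv_inv,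
        ← mul_zpow, mul_comm (b 0)⁻¹, zpow_mul, zpow_natCast] at h1
      have h2 : torusCoeff (s + t) m = torusCoeff t m * torusCoeff s m := by
        simp [torusCoeff, torusChar_add_right, mul_comm]
      exact mul_left_cancel₀ (torusCoeff_ne_zero t m) (h2.symm.trans h1)
    obtain ⟨m₀, hm₀⟩ := (D.primitive 0).exists_dual_eq_one
    refine ⟨torusChar m₀ s, torusCoeff_injective (funext fun m => ?_)⟩
    have h0 := hs m₀
    rw [hm₀, zpow_one] at h0
    rw [hs m, ← h0, torusCoeff, torusCoeff, torusChar_tmul]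
    push_cast
    rfl
  · rintro ⟨r, rfl⟩
    -- a complex root of the real number `r⁻¹` gives an isomorphism which need not be real
    obtain ⟨z, hz⟩ := IsAlgClosed.exists_pow_nat_eq (((r⁻¹ : ℝˣ) : ℝ) : ℂ) (D.pos 0)
    have hz0 : z ≠ 0 := by
      rintro rfl
      rw [zero_pow (D.pos 0).ne'] at hz
      exact (r⁻¹).ne_zero (by exact_mod_cast hz.symm)
    have hl : lform (z • stdVec (0 : Fin 2)) (stdVec (1 : Fin 2)) ≠ 0 := by
      simp [lform, stdVec, hz0]
    obtain ⟨g, hg⟩ := exists_gl_smul_eq hl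
    have h1 := HasMonomialForm.comp_smul D.balanced hφ g (b := ![z, 1]) (v' := stdVec)
      (fun i => by fin_cases i <;> simp [hz0])
      (fun i => by rw [hg]; fin_cases i <;> simp [stdVec])
    refine ⟨g, fun p => ?_⟩
    have h2 : (fun q => φ.1 (g • q)) = ψ.1 := by
      refine HasMonomialForm.unique D.bot_mem D.ray_mem (pairwiseIndep_stdVec D.card) h1 ?_
      unfold IsStd at hψ
      convert hψ using 2 with m
      have hz' : z⁻¹ ^ w 0 = ((r : ℝ) : ℂ) := by
        rw [inv_pow, hz]
        simp
      simp [Fin.prod_univ_two, torusCoeff, torusChar_add_right, torusChar_tmul, ← hz', zpow_mul,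
        mul_comm]
    exact congrFun h2 p

end LineData

/-! ### The action of the real torus on the moduli space -/

namespace LineData

variable {n a : ℕ} {F : Fan n} {u : Fin a → Lat n} {w : Fin a → ℕ}

/-- The action of the torus on parametrized real lines by composition. -/
noncomputable def translate (D : LineData F u w) (t : RealTorus n) (φ : RealLine F u w) :
    RealLine F u w := (D.exists_torusTranslate t φ).choose

theorem translate_apply (D : LineData F u w) (t : RealTorus n) (φ : RealLine F u w) (p : P1) :
    (D.translate t φ).1 p = torusTranslate F t (φ.1 p) :=
  (D.exists_torusTranslate t φ).choose_spec p

/-- The induced action on isomorphism classes. -/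
@[reducible]
noncomputable def moduliAction (D : LineData F u w) :
    AddAction (RealTorus n) (RealLineModuli F u w) where
  vadd t := Quotient.map (D.translate t) (by
    rintro φ ψ ⟨g, hg⟩
    exact ⟨g, fun p => by rw [D.translate_apply, D.translate_apply, hg]⟩)
  zero_vadd L := by
    induction L using Quotient.inductionOn with
    | h φ => exact Quotient.sound ⟨1, fun p => by
        rw [one_smul, D.translate_apply, torusTranslate_zero]⟩
  add_vadd s t L := by
    induction L using Quotient.inductionOn with
    | h φ => exact Quotient.sound ⟨1, fun p => by
        rw [one_smul, D.translate_apply, D.translate_apply, D.translate_apply, torusTranslate_add]⟩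

theorem moduliAction_mk (D : LineData F u w) (t : RealTorus n) (φ : RealLine F u w) :
    D.moduliAction.vadd t (Quotient.mk _ φ) = Quotient.mk _ (D.translate t φ) := rfl

theorem exists_isStd_rep (D : LineData F u w) (L : RealLineModuli F u w) :
    ∃ (t : RealTorus n) (φ : RealLine F u w), IsStd t φ.1 u w ∧ L = Quotient.mk _ φ := by
  induction L using Quotient.inductionOn with
  | h φ =>
  obtain ⟨t, ψ, hψ, h⟩ := D.exists_equiv_isStd φ
  exact ⟨t, ψ, hψ, Quotient.sound h⟩

theorem moduliAction_transitive (D : LineData F u w) (L L' : RealLineModuli F u w) :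
    ∃ t, D.moduliAction.vadd t L = L' := by
  obtain ⟨s, φ, hφ, rfl⟩ := D.exists_isStd_rep L
  obtain ⟨t, ψ, hψ, rfl⟩ := D.exists_isStd_rep L'
  refine ⟨t - s, ?_⟩
  rw [moduliAction_mk]
  congr 1
  have h := isStd_translate hφ (D.translate_apply (t - s) φ)
  rw [sub_add_cancel] at h
  exact Subtype.ext (HasMonomialForm.unique D.bot_mem D.ray_mem (pairwiseIndep_stdVec D.card) h hψ)

theorem moduliAction_stabilizer_of_card_three (D : LineData F u w) (ha : a = 3) (t : RealTorus n)
    (L : RealLineModuli F u w) : D.moduliAction.vadd t L = L ↔ t = 0 := by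
  constructor
  · intro h
    obtain ⟨s, φ, hφ, rfl⟩ := D.exists_isStd_rep L
    rw [moduliAction_mk] at h
    have h1 := D.eq_of_equiv_of_card_three ha (isStd_translate hφ (D.translate_apply t φ)) hφ
      (Quotient.exact h)
    exact add_eq_right.1 h1
  · rintro rfl
    exact D.moduliAction.zero_vadd L

theorem moduliAction_stabilizer_of_card_two {u : Fin 2 → Lat n} {w : Fin 2 → ℕ}
    (D : LineData F u w) (i : Fin 2) (t : RealTorus n) (L : RealLineModuli F u w) :
    D.moduliAction.vadd t L = L ↔ torusProj (u i) t = 0 := by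
  obtain ⟨s, φ, hφ, rfl⟩ := D.exists_isStd_rep L
  have h0 : D.moduliAction.vadd t (Quotient.mk _ φ) = Quotient.mk _ φ ↔
      ∃ r : ℝˣ, t = u 0 ⊗ₜ[ℤ] Additive.ofMul r := by
    rw [moduliAction_mk, eq_comm, Quotient.eq]
    exact D.equiv_iff_of_card_two hφ (isStd_translate hφ (D.translate_apply t φ))
  rw [h0, torusProj_eq_zero_iff]
  fin_cases i
  · rfl
  · -- the two rays are opposite
    have hinv : ∀ r : ℝˣ, u 1 ⊗ₜ[ℤ] Additive.ofMul r⁻¹ = u 0 ⊗ₜ[ℤ] Additive.ofMul r := fun r => by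
      rw [D.neg_of_card_two.1, ofMul_inv, TensorProduct.neg_tmul, TensorProduct.tmul_neg, neg_neg]
    constructor
    · rintro ⟨r, rfl⟩
      exact ⟨r⁻¹, (hinv r).symm⟩
    · rintro ⟨r, rfl⟩
      exact ⟨r⁻¹, by rw [← hinv, inv_inv]; rfl⟩

end LineData

end ToricLines

open ToricLines in
theorem mainTheorem10 {n a : ℕ} (F : Fan n) (ha : a = 2 ∨ a = 3)
    (u : Fin a → Lat n) (w : Fin a → ℕ)
    (hu : ∀ i, IsPrimitive (u i)) (hw : ∀ i, 0 < w i)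
    (hbal : ∑ i, w i • u i = 0)
    (hinj : Function.Injective u) (hray : ∀ i, ray (u i) ∈ F.cones) :
    Nonempty (RealLineModuli F u w) ∧
    ∃ act : AddAction (RealTorus n) (RealLineModuli F u w),
      (∀ (t : RealTorus n) (φ : RealLine F u w), ∃ ψ : RealLine F u w,
        (∀ p, ψ.1 p = torusTranslate F t (φ.1 p)) ∧
        act.vadd t (Quotient.mk _ φ) = Quotient.mk _ ψ) ∧
      (∀ L L' : RealLineModuli F u w, ∃ t, act.vadd t L = L') ∧
      (a = 3 → ∀ L L' : RealLineModuli F u w, ∃! t, act.vadd t L = L') ∧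
      (a = 2 → (∀ i j, Submodule.span ℤ {u i} = Submodule.span ℤ {u j}) ∧
        ∀ i, ∃ act' : AddAction ((Lat n ⧸ Submodule.span ℤ {u i}) ⊗[ℤ] Additive ℝˣ)
            (RealLineModuli F u w),
          (∀ t L, act.vadd t L = act'.vadd (torusProj (u i) t) L) ∧
          ∀ L L' : RealLineModuli F u w, ∃! s, act'.vadd s L = L') := by
  have D : LineData F u w := ⟨ha, hu, hw, hbal, hinj, hray⟩
  obtain ⟨φ₀, -⟩ := D.exists_isStd 0
  refine ⟨⟨Quotient.mk _ φ₀⟩, D.moduliAction,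
    fun t φ => ⟨D.translate t φ, D.translate_apply t φ, rfl⟩, D.moduliAction_transitive, ?_, ?_⟩
  · intro h3 L L'
    obtain ⟨act', h, hunique⟩ := exists_factor_action (id : RealTorus n → RealTorus n)
      (fun _ _ => rfl) Function.surjective_id D.moduliAction D.moduliAction_transitive
      (D.moduliAction_stabilizer_of_card_three h3)
    have h' : ∀ t L, act'.vadd t L = D.moduliAction.vadd t L := fun t L => (h t L).symm
    simpa only [h'] using hunique L L'
  · rintro rfl
    have hspan : Submodule.span ℤ {u 1} = Submodule.span ℤ {u 0} := by
      rw [D.neg_of_card_two.1, ← Set.neg_singleton, Submodule.span_neg]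
    refine ⟨fun i j => ?_, fun i => ?_⟩
    · fin_cases i <;> fin_cases j <;> simp [hspan]
    · exact exists_factor_action (torusProj (u i)) (map_add _)
        (LinearMap.rTensor_surjective _ (Submodule.mkQ_surjective _)) D.moduliAction
        D.moduliAction_transitive (D.moduliAction_stabilizer_of_card_two i)
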